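/- For a convex body $K\subset\mathbb{R}^n$ (a compact convex set with non-empty interior) and $p\in(0,\infty)$, let $|K|$ denote the Lebesgue measure of $K$ and let $$h_{p,K}(y)=\frac1p\log\left(\int_K e^{p\langle x,y\rangle}\frac{dx}{|K|}\right),\quad y\in\mathbb{R}^n,\qquad \mathcal{M}_p(K)=|K|\int_{\mathbb{R}^n}e^{-h_{p,K}(y)}\,dy\in[0,\infty]$$ be its $L^p$-support function and its $L^p$-Mahler volume. Theorem. For every $p\in(0,\infty)$ and every symmetric convex body $K\subset\mathbb{R}^2$ (that is, $K=-K$), $$\mathcal{M}_p(K)\ge\mathcal{M}_p([-1,1]^2).$$ -/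

import Mathlib

open MeasureTheory
open scoped ENNReal

/-- The `L^p`-support function of `K ⊆ ℝⁿ`:
`h_{p,K}(y) = log ((∫_K e^{p⟨x,y⟩} dx / |K|)^{1/p})`. -/
noncomputable def lpSupport {n : ℕ} (p : ℝ) (K : Set (EuclideanSpace ℝ (Fin n)))
    (y : EuclideanSpace ℝ (Fin n)) : ℝ :=
  Real.log (((∫ x in K, Real.exp (p * inner ℝ x y)) / volume.real K) ^ (1 / p))

/-- The `L^p`-Mahler volume of `K ⊆ ℝⁿ`: `M_p(K) = |K| ∫_{ℝⁿ} e^{-h_{p,K}(y)} dy`, as an element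
of `[0, ∞]`. -/
noncomputable def lpMahler {n : ℕ} (p : ℝ) (K : Set (EuclideanSpace ℝ (Fin n))) : ℝ≥0∞ :=
  volume K * ∫⁻ y, ENNReal.ofReal (Real.exp (-lpSupport p K y))

/-- The cube `[-1,1]ⁿ`. -/
def cube (n : ℕ) : Set (EuclideanSpace ℝ (Fin n)) :=
  {x | ∀ i, x i ∈ Set.Icc (-1 : ℝ) 1}

open Filter Topology Set

/-! The proof is a shadow-system argument. Let `K_t` be the image of `K` under `(x₀, x₁) ↦ (x₀ + t
α(x₁), x₁)`, with `α` odd. This shear preserves area and symmetry. With `Z(a, b, z) = ∫_K exp (p (x₀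
a + x₁ b + α(x₁) z))`, the volume `M_p(K_t)` is `|K|^(1 + 1/p)` times `J(t) = ∫∫ Z(a, b, t a)^(-1/p)
da db`. By Hölder `Z` is log-convex, so `Z^(-1/p)` is an even log-concave function on three-space,
and `J(t)` is its integral over the plane `z = t a` in the coordinates `(a, b)`. Busemann's theorem
for such functions (`busemann_log_concave`) says that `1/J` is convex. It follows from
Prékopa–Leindler in `b` and Ball's radial inequality in `a`. Hence `M_p(K_0)` is at least the
smaller of `M_p(K_t)` at any two parameters on either side of `0` (`min_lpMahler_le_of_shadow`).

For a symmetric polygon, move one antipodal pair of vertices parallel to the line joining the two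
neighbours of one of them, in both directions, until a neighbour becomes redundant. Both end
polygons have fewer vertices and one of them has no larger `M_p`
(`Capped.exists_fewer_min_lpMahler_le`). Induction on the number of points ends at a parallelogram,
which is a linear image of the square, and `M_p` is linearly invariant (`lpMahler_image_linearMap`).

A general `K` lies in a symmetric polygon contained in `c K` with `c > 1`. The estimate
`lpMahler_mul_le_of_subset` loses only a power of the ratio of areas, which tends to `1` as `c → 1`.
-/

/-! ### Monotone transport and the one-dimensional Prékopa–Leindler inequality. -/

theorem hasDerivAt_integral_Iic {f : ℝ → ℝ} (hf : Continuous f) (hi : Integrable f) (x : ℝ) :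
    HasDerivAt (fun x => ∫ t in Iic x, f t) (f x) x := by
  have h : (fun x => ∫ t in Iic x, f t) = fun x => (∫ t in (0 : ℝ)..x, f t) + ∫ t in Iic 0, f t := by
    funext y
    rw [← intervalIntegral.integral_Iic_sub_Iic hi.integrableOn hi.integrableOn]
    ring
  rw [h]
  exact (intervalIntegral.integral_hasDerivAt_right (hf.intervalIntegrable _ _)
    hf.stronglyMeasurable.stronglyMeasurableAtFilter hf.continuousAt).add_const _

theorem strictMono_integral_Iic {f : ℝ → ℝ} (hf : Continuous f) (hp : ∀ x, 0 < f x)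
    (hi : Integrable f) : StrictMono (fun x => ∫ t in Iic x, f t) := by
  apply strictMono_of_deriv_pos
  intro x
  rw [(hasDerivAt_integral_Iic hf hi x).deriv]
  exact hp x

theorem tendsto_integral_Iic_atTop {f : ℝ → ℝ} (hi : Integrable f) :
    Tendsto (fun x => ∫ t in Iic x, f t) atTop (𝓝 (∫ t, f t)) := by
  have := tendsto_setIntegral_of_monotone (μ := volume) (f := f) (s := fun x : ℝ => Iic x)
    (fun _ => measurableSet_Iic) (fun _ _ h => Iic_subset_Iic.2 h) hi.integrableOn
  rwa [iUnion_Iic, setIntegral_univ] at this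

theorem tendsto_integral_Iic_atBot (f : ℝ → ℝ) :
    Tendsto (fun x => ∫ t in Iic x, f t) atBot (𝓝 0) :=
  tendsto_integral_Iic_zero (f := f) (a := fun x : ℝ => x) tendsto_id

theorem integral_pos_of_continuous_pos {f : ℝ → ℝ} (hf : Continuous f) (hp : ∀ x, 0 < f x)
    (hi : Integrable f) : 0 < ∫ t, f t :=
  integral_pos_of_integrable_nonneg_nonzero hf hi (fun x => (hp x).le) (hp 0).ne'

theorem integral_Iic_mem_Ioo {f : ℝ → ℝ} (hf : Continuous f) (hp : ∀ x, 0 < f x)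
    (hi : Integrable f) (x : ℝ) : (∫ t in Iic x, f t) ∈ Ioo 0 (∫ t, f t) := by
  have hm := strictMono_integral_Iic hf hp hi
  constructor
  · exact (hm.monotone.le_of_tendsto (tendsto_integral_Iic_atBot f) (x - 1)).trans_lt
      (hm (by linarith))
  · exact (hm (show x < x + 1 by linarith)).trans_le
      (hm.monotone.ge_of_tendsto (tendsto_integral_Iic_atTop hi) (x + 1))

theorem exists_integral_Iic_eq {f : ℝ → ℝ} (hf : Continuous f) (hi : Integrable f)
    {v : ℝ} (hv : v ∈ Ioo 0 (∫ t, f t)) : ∃ x, (∫ t in Iic x, f t) = v := by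
  have hc : Continuous (fun x => ∫ t in Iic x, f t) :=
    continuous_iff_continuousAt.2 fun x => (hasDerivAt_integral_Iic hf hi x).continuousAt
  obtain ⟨a, ha⟩ := ((tendsto_integral_Iic_atBot f).eventually (gt_mem_nhds hv.1)).exists
  obtain ⟨b, hb⟩ := ((tendsto_integral_Iic_atTop hi).eventually (lt_mem_nhds hv.2)).exists
  exact mem_range_of_exists_le_of_exists_ge hc ⟨a, ha.le⟩ ⟨b, hb.le⟩

/-- Monotone transport between two positive continuous integrable densities on the line. -/
theorem exists_transport {f k : ℝ → ℝ} (hf : Continuous f) (hfp : ∀ x, 0 < f x)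
    (hfi : Integrable f) (hk : Continuous k) (hkp : ∀ x, 0 < k x) (hki : Integrable k) :
    ∃ φ : ℝ → ℝ, ∀ x, HasDerivAt φ (f x * (∫ t, k t) / ((∫ t, f t) * k (φ x))) x := by
  set A := ∫ t, f t with hA
  set B := ∫ t, k t with hB
  have hA0 : 0 < A := integral_pos_of_continuous_pos hf hfp hfi
  have hB0 : 0 < B := integral_pos_of_continuous_pos hk hkp hki
  set G : ℝ → ℝ := fun x => ∫ t in Iic x, k t with hG
  have hGm : StrictMono G := strictMono_integral_Iic hk hkp hki
  have hex : ∀ v ∈ Ioo 0 B, G (Function.invFun G v) = v := fun v hv =>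
    Function.invFun_eq (exists_integral_Iic_eq hk hki hv)
  have hmono : MonotoneOn (Function.invFun G) (Ioo 0 B) := by
    intro u hu v hv huv
    rw [← hGm.le_iff_le, hex u hu, hex v hv]
    exact huv
  have himg : (Function.invFun G) '' (Ioo 0 B) = univ := by
    rw [eq_univ_iff_forall]
    intro y
    exact ⟨G y, integral_Iic_mem_Ioo hk hkp hki y, Function.leftInverse_invFun hGm.injective y⟩
  have hinv : ∀ v ∈ Ioo 0 B, HasDerivAt (Function.invFun G) (k (Function.invFun G v))⁻¹ v := by
    intro v hv
    have hn : Ioo 0 B ∈ 𝓝 v := Ioo_mem_nhds hv.1 hv.2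
    refine HasDerivAt.of_local_left_inverse
      (continuousAt_of_monotoneOn_of_image_mem_nhds hmono hn (by rw [himg]; exact univ_mem))
      (hasDerivAt_integral_Iic hk hki _) (hkp _).ne' ?_
    filter_upwards [hn] with u hu using hex u hu
  have hmem : ∀ x, (∫ t in Iic x, f t) * (B / A) ∈ Ioo 0 B := by
    intro x
    have h := integral_Iic_mem_Ioo hf hfp hfi x
    refine ⟨mul_pos h.1 (div_pos hB0 hA0), ?_⟩
    calc _ < A * (B / A) := mul_lt_mul_of_pos_right h.2 (div_pos hB0 hA0)
      _ = B := by field_simp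
  -- The transport matches normalised distribution functions. The factor `B / A` puts the argument
  -- into `(0, B)`, where `invFun G` is a true inverse.
  refine ⟨fun x => Function.invFun G ((∫ t in Iic x, f t) * (B / A)), fun x => ?_⟩
  have := (hinv _ (hmem x)).comp x ((hasDerivAt_integral_Iic hf hfi x).mul_const (B / A))
  refine this.congr_deriv ?_
  have := (hkp (Function.invFun G ((∫ t in Iic x, f t) * (B / A)))).ne'
  field_simp

/-- Lower bound for an integral by a change of variables along an increasing map. -/
theorem le_integral_of_deriv_bound {f h W W' : ℝ → ℝ} {M : ℝ} (hfi : Integrable f)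
    (hf0 : 0 < ∫ t, f t)
    (hh : ∀ x, 0 ≤ h x) (hhi : Integrable h) (hW : ∀ x, HasDerivAt W (W' x) x)
    (hW' : ∀ x, 0 < W' x) (hM0 : 0 ≤ M) (hfn : ∀ x, 0 ≤ f x)
    (hM : ∀ x, M * f x / (∫ t, f t) ≤ h (W x) * W' x) : M ≤ ∫ x, h x := by
  have hinj : InjOn W univ := by
    refine (strictMono_of_deriv_pos fun x => ?_).injective.injOn
    rw [(hW x).deriv]
    exact hW' x
  have key := lintegral_image_eq_lintegral_abs_deriv_mul MeasurableSet.univ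
    (fun x _ => (hW x).hasDerivWithinAt) hinj (fun x => ENNReal.ofReal (h x))
  have h1 : ENNReal.ofReal M ≤ ENNReal.ofReal (∫ x, h x) := by
    rw [ofReal_integral_eq_lintegral_ofReal hhi (Eventually.of_forall hh)]
    calc ENNReal.ofReal M = ENNReal.ofReal (∫ x, M * f x / (∫ t, f t)) := by
          rw [integral_div, integral_const_mul, mul_div_assoc, div_self hf0.ne', mul_one]
      _ = ∫⁻ x, ENNReal.ofReal (M * f x / (∫ t, f t)) :=
          ofReal_integral_eq_lintegral_ofReal ((hfi.const_mul M).div_const _)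
            (Eventually.of_forall fun x => div_nonneg (mul_nonneg hM0 (hfn x)) hf0.le)
      _ ≤ ∫⁻ x, ENNReal.ofReal (|W' x|) * ENNReal.ofReal (h (W x)) := by
          refine lintegral_mono fun x => ?_
          rw [abs_of_pos (hW' x), ← ENNReal.ofReal_mul (hW' x).le, mul_comm (W' x)]
          exact ENNReal.ofReal_le_ofReal (hM x)
      _ = ∫⁻ x in W '' univ, ENNReal.ofReal (h x) := by rw [key, setLIntegral_univ]
      _ ≤ _ := setLIntegral_le_lintegral _ _
  exact (ENNReal.ofReal_le_ofReal_iff (integral_nonneg hh)).1 h1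

/-- The one-dimensional Prékopa–Leindler inequality, for positive continuous densities. -/
theorem prekopa_leindler {f k h : ℝ → ℝ} (hf : Continuous f) (hfp : ∀ x, 0 < f x)
    (hfi : Integrable f) (hk : Continuous k) (hkp : ∀ x, 0 < k x) (hki : Integrable k)
    (hh : ∀ x, 0 ≤ h x) (hhi : Integrable h) {a b : ℝ} (ha : 0 < a) (hb : 0 < b) (hab : a + b = 1)
    (H : ∀ x y, f x ^ a * k y ^ b ≤ h (a * x + b * y)) :
    (∫ x, f x) ^ a * (∫ x, k x) ^ b ≤ ∫ x, h x := by
  obtain ⟨φ, hφ⟩ := exists_transport hf hfp hfi hk hkp hki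
  have hA0 : 0 < ∫ t, f t := integral_pos_of_continuous_pos hf hfp hfi
  have hB0 : 0 < ∫ t, k t := integral_pos_of_continuous_pos hk hkp hki
  set A := ∫ t, f t with hA
  set B := ∫ t, k t with hB
  have hd : ∀ x, 0 < f x * B / (A * k (φ x)) := fun x =>
    div_pos (mul_pos (hfp x) hB0) (mul_pos hA0 (hkp _))
  refine le_integral_of_deriv_bound (W := fun x => a * x + b * φ x)
    (W' := fun x => a * 1 + b * (f x * B / (A * k (φ x)))) hfi hA0 hh hhi
    (fun x => ((hasDerivAt_id x).const_mul a).add ((hφ x).const_mul b))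
    (fun x => by have := hd x; positivity) (by positivity) (fun x => (hfp x).le) fun x => ?_
  have hx := hfp x
  have hy := hkp (φ x)
  -- Weighted AM–GM for `1` and `φ'`, whose arithmetic mean is the derivative of `a x + b φ(x)`.
  have h1 : (f x * B / (A * k (φ x))) ^ b ≤ a * 1 + b * (f x * B / (A * k (φ x))) := by
    have := Real.geom_mean_le_arith_mean2_weighted ha.le hb.le zero_le_one (hd x).le hab
    rwa [Real.one_rpow, one_mul] at this
  calc A ^ a * B ^ b * f x / A = f x ^ a * k (φ x) ^ b * (f x * B / (A * k (φ x))) ^ b := by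
        rw [Real.div_rpow (by positivity) (by positivity), Real.mul_rpow hx.le hB0.le,
          Real.mul_rpow hA0.le hy.le]
        have e1 : f x = f x ^ a * f x ^ b := by rw [← Real.rpow_add hx, hab, Real.rpow_one]
        have e2 : A = A ^ a * A ^ b := by rw [← Real.rpow_add hA0, hab, Real.rpow_one]
        have h3 := (Real.rpow_pos_of_pos hA0 a).ne'
        have h4 := (Real.rpow_pos_of_pos hA0 b).ne'
        have h5 := (Real.rpow_pos_of_pos hy b).ne'
        calc A ^ a * B ^ b * f x / A = A ^ a * B ^ b * (f x ^ a * f x ^ b) / (A ^ a * A ^ b) := by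
              rw [← e1, ← e2]
          _ = _ := by field_simp
    _ ≤ h (a * x + b * φ x) * (a * 1 + b * (f x * B / (A * k (φ x)))) :=
        mul_le_mul (H x (φ x)) h1 (Real.rpow_nonneg (hd x).le _) (hh _)

/-! ### Ball's inequality for integrals over half-lines. -/

/-- Change of variables `r = e^u` in an integral over the half-line. -/
theorem integral_Ioi_eq_integral_exp (f : ℝ → ℝ) :
    ∫ r in Ioi 0, f r = ∫ u, f (Real.exp u) * Real.exp u := by
  have := integral_image_eq_integral_abs_deriv_smul (f := Real.exp) (f' := Real.exp)
    MeasurableSet.univ (fun x _ => (Real.hasDerivAt_exp x).hasDerivWithinAt)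
    Real.exp_injective.injOn f
  rw [image_univ, Real.range_exp, setIntegral_univ] at this
  rw [this]
  simp [abs_of_pos (Real.exp_pos _), mul_comm]

theorem integrable_exp_of_integrableOn_Ioi {f : ℝ → ℝ} (hf : IntegrableOn f (Ioi 0)) :
    Integrable fun u => f (Real.exp u) * Real.exp u := by
  have := integrableOn_image_iff_integrableOn_abs_deriv_smul (f := Real.exp) (f' := Real.exp)
    MeasurableSet.univ (fun x _ => (Real.hasDerivAt_exp x).hasDerivWithinAt)
    Real.exp_injective.injOn f
  rw [image_univ, Real.range_exp] at this
  have := integrableOn_univ.1 (this.1 hf)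
  simpa [abs_of_pos (Real.exp_pos _), mul_comm] using this

/-- Ball's inequality: harmonic concavity of the radial integrals of a log-concave function. -/
theorem ball_radial_inequality {f k h : ℝ → ℝ} (hf : Continuous f) (hfp : ∀ x, 0 < f x)
    (hfi : IntegrableOn f (Ioi 0)) (hk : Continuous k) (hkp : ∀ x, 0 < k x)
    (hki : IntegrableOn k (Ioi 0)) (hh : ∀ x, 0 ≤ h x) (hhi : IntegrableOn h (Ioi 0))
    {a b : ℝ} (ha : 0 < a) (hb : 0 < b)
    (H : ∀ r s, 0 < r → 0 < s → f r ^ (a / r / (a / r + b / s)) * k s ^ (b / s / (a / r + b / s)) ≤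
      h (1 / (a / r + b / s))) :
    1 / (a / (∫ x in Ioi 0, f x) + b / (∫ x in Ioi 0, k x)) ≤ ∫ x in Ioi 0, h x := by
  rw [integral_Ioi_eq_integral_exp f, integral_Ioi_eq_integral_exp k,
    integral_Ioi_eq_integral_exp h]
  have hfe : Continuous fun u => f (Real.exp u) * Real.exp u := by fun_prop
  have hke : Continuous fun u => k (Real.exp u) * Real.exp u := by fun_prop
  have hfep : ∀ u, 0 < f (Real.exp u) * Real.exp u := fun u => mul_pos (hfp _) (Real.exp_pos u)
  have hkep : ∀ u, 0 < k (Real.exp u) * Real.exp u := fun u => mul_pos (hkp _) (Real.exp_pos u)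
  have hfei := integrable_exp_of_integrableOn_Ioi hfi
  have hkei := integrable_exp_of_integrableOn_Ioi hki
  have hhei := integrable_exp_of_integrableOn_Ioi hhi
  obtain ⟨φ, hφ⟩ := exists_transport hfe hfep hfei hke hkep hkei
  have hA0 := integral_pos_of_continuous_pos hfe hfep hfei
  have hB0 := integral_pos_of_continuous_pos hke hkep hkei
  set A := ∫ u, f (Real.exp u) * Real.exp u with hA
  set B := ∫ u, k (Real.exp u) * Real.exp u with hB
  set D : ℝ → ℝ := fun x => f (Real.exp x) * Real.exp x * B / (A * (k (Real.exp (φ x)) * Real.exp (φ x)))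
    with hD
  have hd : ∀ x, 0 < D x := fun x => div_pos (mul_pos (hfep x) hB0) (mul_pos hA0 (hkep _))
  -- `1 / S` is the weighted harmonic mean of `r = e^x` and `s = e^(φ x)`. In logarithmic
  -- coordinates the transport is therefore along `W = -log S`.
  set S : ℝ → ℝ := fun x => a * Real.exp (-x) + b * Real.exp (-φ x) with hS
  have hSp : ∀ x, 0 < S x := fun x => by positivity
  have hSd : ∀ x, HasDerivAt S (a * (Real.exp (-x) * (-1)) + b * (Real.exp (-φ x) * (-D x))) x :=
    fun x => (((hasDerivAt_id x).neg.exp).const_mul a).add (((hφ x).neg.exp).const_mul b)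
  refine le_integral_of_deriv_bound (W := fun x => -Real.log (S x))
    (W' := fun x => (a * Real.exp (-x) + b * Real.exp (-φ x) * D x) / S x) hfei hA0
    (fun x => mul_nonneg (hh _) (Real.exp_pos x).le) hhei
    (fun x => (((hSd x).log (hSp x).ne').neg).congr_deriv (by ring))
    (fun x => div_pos (by have := hd x; positivity) (hSp x)) (by positivity) (fun x => (hfep x).le)
    fun x => ?_
  have hr := Real.exp_pos x
  have hs := Real.exp_pos (φ x)
  have hHx := H _ _ hr hs
  have hDx := hd x
  have hDe : D x = f (Real.exp x) * Real.exp x * B / (A * (k (Real.exp (φ x)) * Real.exp (φ x))) := rfl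
  have hSe : S x = a / Real.exp x + b / Real.exp (φ x) := by
    simp only [hS, Real.exp_neg]
    ring
  have hfx := hfp (Real.exp x)
  have hkx := hkp (Real.exp (φ x))
  have hSx := hSp x
  simp only [Real.exp_neg]
  rw [Real.exp_log (hSp x)]
  generalize D x = δ at *
  generalize S x = σ at *
  rw [← hSe] at hHx
  generalize Real.exp x = r at *
  generalize Real.exp (φ x) = s at *
  generalize f r = F at *
  generalize k s = K at *
  rw [one_div] at hHx
  generalize h σ⁻¹ = Hh at *
  set θ := a / r / σ with hθ
  set η := b / s / σ with hη
  have hθ0 : 0 < θ := by positivity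
  have hη0 : 0 < η := by positivity
  have hθη : θ + η = 1 := by
    rw [hθ, hη, ← add_div, ← hSe, div_self hSx.ne']
  have e1 : (a * r⁻¹ + b * s⁻¹ * δ) / σ = θ * 1 + η * δ := by
    rw [hθ, hη]; field_simp
  have g1 : δ ^ η ≤ θ * 1 + η * δ := by
    have := Real.geom_mean_le_arith_mean2_weighted hθ0.le hη0.le zero_le_one hDx.le hθη
    rwa [Real.one_rpow, one_mul] at this
  -- A second AM–GM: since `θ r σ = a` and `η s σ = b`, the arithmetic mean is exactly the
  -- reciprocal of the desired bound.
  have g2 : (r * σ / A) ^ θ * (s * σ / B) ^ η ≤ a / A + b / B := by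
    refine (Real.geom_mean_le_arith_mean2_weighted hθ0.le hη0.le (by positivity)
      (by positivity) hθη).trans_eq ?_
    rw [hθ, hη]; field_simp
  have split : ∀ z : ℝ, 0 < z → z ^ θ * z ^ η = z := fun z hz => by
    rw [← Real.rpow_add hz, hθη, Real.rpow_one]
  have g3 : F * r / A = (F ^ θ * K ^ η * σ⁻¹ * δ ^ η) * ((r * σ / A) ^ θ * (s * σ / B) ^ η) := by
    rw [hDe]
    rw [Real.div_rpow (by positivity) (by positivity), Real.mul_rpow (by positivity) hB0.le,
      Real.mul_rpow hfx.le hr.le, Real.mul_rpow hA0.le (by positivity), Real.mul_rpow hkx.le hs.le,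
      Real.div_rpow (by positivity) (by positivity), Real.div_rpow (by positivity) (by positivity),
      Real.mul_rpow hr.le hSx.le, Real.mul_rpow hs.le hSx.le]
    have hp : ∀ z : ℝ, 0 < z → ∀ t : ℝ, z ^ t ≠ 0 := fun z hz t => (Real.rpow_pos_of_pos hz t).ne'
    have n1 := hp A hA0 θ
    have n2 := hp A hA0 η
    have n3 := hp B hB0 η
    have n4 := hp K hkx η
    have n5 := hp s hs η
    have n6 := hp σ hSx η
    have n7 := hp σ hSx θ
    calc F * r / A = (F ^ θ * F ^ η) * (r ^ θ * r ^ η) / (A ^ θ * A ^ η) := by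
          rw [split F hfx, split r hr, split A hA0]
      _ = F ^ θ * (σ ^ θ * σ ^ η)⁻¹ * F ^ η * (r ^ θ * r ^ η) / (A ^ θ * A ^ η) * (σ ^ θ * σ ^ η) := by
          field_simp
      _ = F ^ θ * (σ)⁻¹ * F ^ η * (r ^ θ * r ^ η) / (A ^ θ * A ^ η) * (σ ^ θ * σ ^ η) := by
          rw [split σ hSx]
      _ = _ := by field_simp
  have hD0 : 0 < a / A + b / B := by positivity
  calc 1 / (a / A + b / B) * (F * r) / A = 1 / (a / A + b / B) * (F * r / A) := by ring
    _ ≤ F ^ θ * K ^ η * σ⁻¹ * δ ^ η := by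
        rw [g3, one_div, inv_mul_le_iff₀ hD0, mul_comm]
        exact mul_le_mul_of_nonneg_right g2 (by positivity)
    _ ≤ Hh * σ⁻¹ * ((a * r⁻¹ + b * s⁻¹ * δ) / σ) := by
        rw [e1]
        refine mul_le_mul (mul_le_mul_of_nonneg_right hHx (by positivity)) g1 (by positivity) ?_
        exact mul_nonneg ((by positivity : (0:ℝ) ≤ F ^ θ * K ^ η).trans hHx) (by positivity)

/-! ### Busemann's theorem for even log-concave functions of three variables. -/

theorem integrable_exp_neg_mul_abs {δ : ℝ} (hδ : 0 < δ) :
    Integrable fun x : ℝ => Real.exp (-(δ * |x|)) := by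
  have h : IntegrableOn (fun x : ℝ => Real.exp (-δ * x)) (Ioi 0) := exp_neg_integrableOn_Ioi 0 hδ
  have h1 : IntegrableOn (fun x : ℝ => Real.exp (-(δ * |x|))) (Ioi 0) :=
    h.congr_fun (fun x hx => by simp [abs_of_pos (mem_Ioi.1 hx)]) measurableSet_Ioi
  have h2 : IntegrableOn (fun x : ℝ => Real.exp (-(δ * |x|))) (Iio 0) := by
    have := IntegrableOn.comp_neg_Iio (c := (0 : ℝ)) (μ := volume)
      (f := fun x : ℝ => Real.exp (-(δ * |x|))) (by simpa using h1)
    simpa using this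
  rw [← integrableOn_univ, ← Iio_union_Ici (a := (0 : ℝ))]
  exact h2.union (Iff.mpr integrableOn_Ici_iff_integrableOn_Ioi h1)

section core

variable {f : ℝ → ℝ → ℝ → ℝ} {C δ : ℝ}

theorem integrable_section (hc : Continuous fun w : ℝ × ℝ × ℝ => f w.1 w.2.1 w.2.2)
    (hp : ∀ a b z, 0 < f a b z) (hδ : 0 < δ)
    (hb : ∀ a b z, f a b z ≤ C * (Real.exp (-(δ * |a|)) * Real.exp (-(δ * |b|)))) (a z : ℝ) :
    Integrable fun b => f a b z := by
  refine ((integrable_exp_neg_mul_abs hδ).const_mul (C * Real.exp (-(δ * |a|)))).mono'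
    (by fun_prop : Continuous fun b => f a b z).aestronglyMeasurable (Eventually.of_forall fun b => ?_)
  rw [Real.norm_of_nonneg (hp a b z).le, mul_assoc]
  exact hb a b z

theorem marginal_le (hc : Continuous fun w : ℝ × ℝ × ℝ => f w.1 w.2.1 w.2.2)
    (hp : ∀ a b z, 0 < f a b z) (hδ : 0 < δ)
    (hb : ∀ a b z, f a b z ≤ C * (Real.exp (-(δ * |a|)) * Real.exp (-(δ * |b|)))) (a z : ℝ) :
    ∫ b, f a b z ≤ C * (∫ b, Real.exp (-(δ * |b|))) * Real.exp (-(δ * |a|)) := by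
  calc ∫ b, f a b z ≤ ∫ b, C * Real.exp (-(δ * |a|)) * Real.exp (-(δ * |b|)) := by
        refine integral_mono (integrable_section hc hp hδ hb a z)
          ((integrable_exp_neg_mul_abs hδ).const_mul _) fun b => ?_
        rw [mul_assoc]
        exact hb a b z
    _ = _ := by rw [integral_const_mul]; ring

theorem continuous_marginal (hc : Continuous fun w : ℝ × ℝ × ℝ => f w.1 w.2.1 w.2.2)
    (hp : ∀ a b z, 0 < f a b z) (hδ : 0 < δ) (hC : 0 ≤ C)
    (hb : ∀ a b z, f a b z ≤ C * (Real.exp (-(δ * |a|)) * Real.exp (-(δ * |b|)))) :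
    Continuous fun w : ℝ × ℝ => ∫ b, f w.1 b w.2 := by
  refine continuous_of_dominated (bound := fun b => C * Real.exp (-(δ * |b|)))
    (fun w => (integrable_section hc hp hδ hb w.1 w.2).aestronglyMeasurable)
    (fun w => Eventually.of_forall fun b => ?_)
    ((integrable_exp_neg_mul_abs hδ).const_mul _) (Eventually.of_forall fun b => by fun_prop)
  rw [Real.norm_of_nonneg (hp _ _ _).le]
  refine (hb _ _ _).trans (mul_le_mul_of_nonneg_left ?_ hC)
  have h1 : Real.exp (-(δ * |w.1|)) ≤ 1 := Real.exp_le_one_iff.2 (by simp; positivity)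
  nlinarith [Real.exp_pos (-(δ * |b|))]

theorem marginal_pos (hc : Continuous fun w : ℝ × ℝ × ℝ => f w.1 w.2.1 w.2.2)
    (hp : ∀ a b z, 0 < f a b z) (hδ : 0 < δ)
    (hb : ∀ a b z, f a b z ≤ C * (Real.exp (-(δ * |a|)) * Real.exp (-(δ * |b|)))) (a z : ℝ) :
    0 < ∫ b, f a b z :=
  integral_pos_of_continuous_pos (by fun_prop) (fun b => hp a b z)
    (integrable_section hc hp hδ hb a z)

theorem marginal_even (he : ∀ a b z, f (-a) (-b) (-z) = f a b z) (a z : ℝ) :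
    ∫ b, f (-a) b (-z) = ∫ b, f a b z := by
  rw [← integral_neg_eq_self]
  simp only [he]

/-- Prékopa–Leindler in the variable `b` alone. Integrating `b` out reduces plane integrals to
integrals along lines in the `(a, z)`-plane. -/
theorem marginal_log_concave (hc : Continuous fun w : ℝ × ℝ × ℝ => f w.1 w.2.1 w.2.2)
    (hp : ∀ a b z, 0 < f a b z) (hδ : 0 < δ)
    (hb : ∀ a b z, f a b z ≤ C * (Real.exp (-(δ * |a|)) * Real.exp (-(δ * |b|))))
    (hl : ∀ a b z a' b' z' s t, 0 < s → 0 < t → s + t = 1 →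
      f a b z ^ s * f a' b' z' ^ t ≤ f (s * a + t * a') (s * b + t * b') (s * z + t * z'))
    (a z a' z' s t : ℝ) (hs : 0 < s) (ht : 0 < t) (hst : s + t = 1) :
    (∫ b, f a b z) ^ s * (∫ b, f a' b z') ^ t ≤ ∫ b, f (s * a + t * a') b (s * z + t * z') :=
  prekopa_leindler (by fun_prop) (fun b => hp a b z) (integrable_section hc hp hδ hb a z)
    (by fun_prop) (fun b => hp a' b z') (integrable_section hc hp hδ hb a' z')
    (fun b => (hp _ _ _).le) (integrable_section hc hp hδ hb _ _) hs ht hst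
    fun x y => hl a x z a' y z' s t hs ht hst

theorem integrable_marginal (hc : Continuous fun w : ℝ × ℝ × ℝ => f w.1 w.2.1 w.2.2)
    (hp : ∀ a b z, 0 < f a b z) (hδ : 0 < δ) (hC : 0 ≤ C)
    (hb : ∀ a b z, f a b z ≤ C * (Real.exp (-(δ * |a|)) * Real.exp (-(δ * |b|)))) (t : ℝ) :
    Integrable fun a => ∫ b, f a b (t * a) := by
  have hcm := continuous_marginal hc hp hδ hC hb
  have hcont : Continuous fun a => ∫ b, f a b (t * a) :=
    hcm.comp (by fun_prop : Continuous fun a : ℝ => (a, t * a))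
  refine ((integrable_exp_neg_mul_abs hδ).const_mul (C * (∫ b, Real.exp (-(δ * |b|))))).mono'
    hcont.aestronglyMeasurable (Eventually.of_forall fun a => ?_)
  rw [Real.norm_of_nonneg (marginal_pos hc hp hδ hb _ _).le]
  exact marginal_le hc hp hδ hb _ _

/-- Busemann's theorem for even log-concave functions on three-space: harmonic concavity of the
integral over the plane `z = t a`. -/
theorem busemann_log_concave (hc : Continuous fun w : ℝ × ℝ × ℝ => f w.1 w.2.1 w.2.2)
    (hp : ∀ a b z, 0 < f a b z) (hδ : 0 < δ) (hC : 0 ≤ C)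
    (hb : ∀ a b z, f a b z ≤ C * (Real.exp (-(δ * |a|)) * Real.exp (-(δ * |b|))))
    (he : ∀ a b z, f (-a) (-b) (-z) = f a b z)
    (hl : ∀ a b z a' b' z' s t, 0 < s → 0 < t → s + t = 1 →
      f a b z ^ s * f a' b' z' ^ t ≤ f (s * a + t * a') (s * b + t * b') (s * z + t * z'))
    (t t' : ℝ) {s s' : ℝ} (hs : 0 < s) (hs' : 0 < s') (hss : s + s' = 1) :
    1 / (s / (∫ a, ∫ b, f a b (t * a)) + s' / (∫ a, ∫ b, f a b (t' * a))) ≤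
      ∫ a, ∫ b, f a b ((s * t + s' * t') * a) := by
  have hcm := continuous_marginal hc hp hδ hC hb
  have hcont : ∀ t : ℝ, Continuous fun a => ∫ b, f a b (t * a) := fun t =>
    hcm.comp (by fun_prop : Continuous fun a : ℝ => (a, t * a))
  have hint := integrable_marginal hc hp hδ hC hb
  have hpos : ∀ t a : ℝ, 0 < ∫ b, f a b (t * a) := fun t a => marginal_pos hc hp hδ hb _ _
  -- The marginal is even along each line through the origin, so half-lines, where Ball's inequality
  -- applies, suffice.
  have half : ∀ t : ℝ, ∫ a, ∫ b, f a b (t * a) = 2 * ∫ a in Ioi 0, ∫ b, f a b (t * a) := by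
    intro t
    rw [← integral_comp_abs (f := fun a => ∫ b, f a b (t * a))]
    congr 1
    funext a
    rcases abs_choice a with h | h
    · rw [h]
    · rw [h, mul_neg, marginal_even he]
  have key := ball_radial_inequality (hcont t) (hpos t) (hint t).integrableOn (hcont t') (hpos t')
    (hint t').integrableOn (fun a => (hpos (s * t + s' * t') a).le)
    (hint (s * t + s' * t')).integrableOn hs hs' (fun r u hr hu => by
      have hσ : 0 < s / r + s' / u := by positivity
      set σ := s / r + s' / u with hσe
      have h1 : s / r / σ + s' / u / σ = 1 := by rw [← add_div, div_self hσ.ne']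
      have := marginal_log_concave hc hp hδ hb hl r (t * r) u (t' * u) (s / r / σ) (s' / u / σ)
        (by positivity) (by positivity) h1
      refine this.trans_eq ?_
      -- These weights are chosen so that the combination of points on the lines of slope `t` and
      -- `t'` lies on the line of slope `s t + s' t'`, at the harmonic mean `1 / σ`.
      have e1 : s / r / σ * r + s' / u / σ * u = 1 / σ := by
        rw [← hss]; field_simp
      have e2 : s / r / σ * (t * r) + s' / u / σ * (t' * u) = (s * t + s' * t') * (1 / σ) := by
        field_simp
      rw [e1, e2])
  rw [half t, half t', half]
  set A := ∫ a in Ioi 0, ∫ b, f a b (t * a)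
  set B := ∫ a in Ioi 0, ∫ b, f a b (t' * a)
  calc 1 / (s / (2 * A) + s' / (2 * B)) = 2 * (1 / (s / A + s' / B)) := by
        rw [mul_comm 2 A, mul_comm 2 B, ← div_div, ← div_div, ← add_div, one_div_div]; ring
    _ ≤ _ := mul_le_mul_of_nonneg_left key zero_le_two

/-- For `t < 0 < t'`, the slope `0` is the convex combination of `t` and `t'` with weights `t'/(t' -
t)` and `-t/(t' - t)`, and a weighted harmonic mean is at least the minimum. The extended integrals
are the form in which `lpMahler` is given. -/
theorem min_le_lintegral_plane (hc : Continuous fun w : ℝ × ℝ × ℝ => f w.1 w.2.1 w.2.2)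
    (hp : ∀ a b z, 0 < f a b z) (hδ : 0 < δ) (hC : 0 ≤ C)
    (hb : ∀ a b z, f a b z ≤ C * (Real.exp (-(δ * |a|)) * Real.exp (-(δ * |b|))))
    (he : ∀ a b z, f (-a) (-b) (-z) = f a b z)
    (hl : ∀ a b z a' b' z' s t, 0 < s → 0 < t → s + t = 1 →
      f a b z ^ s * f a' b' z' ^ t ≤ f (s * a + t * a') (s * b + t * b') (s * z + t * z'))
    {t t' : ℝ} (ht : t ≤ 0) (ht' : 0 ≤ t') :
    min (∫⁻ w : ℝ × ℝ, ENNReal.ofReal (f w.1 w.2 (t * w.1)))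
      (∫⁻ w : ℝ × ℝ, ENNReal.ofReal (f w.1 w.2 (t' * w.1))) ≤
      ∫⁻ w : ℝ × ℝ, ENNReal.ofReal (f w.1 w.2 0) := by
  have hint := integrable_marginal hc hp hδ hC hb
  have hpos : ∀ t a : ℝ, 0 < ∫ b, f a b (t * a) := fun t a => marginal_pos hc hp hδ hb _ _
  have hcm := continuous_marginal hc hp hδ hC hb
  have hJ : ∀ t : ℝ, 0 < ∫ a, ∫ b, f a b (t * a) := fun t =>
    integral_pos_of_continuous_pos (hcm.comp (by fun_prop : Continuous fun a : ℝ => (a, t * a)))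
      (hpos t) (hint t)
  have hL : ∀ t : ℝ, ∫⁻ w : ℝ × ℝ, ENNReal.ofReal (f w.1 w.2 (t * w.1)) =
      ENNReal.ofReal (∫ a, ∫ b, f a b (t * a)) := by
    intro t
    have hcf : Continuous fun w : ℝ × ℝ => f w.1 w.2 (t * w.1) :=
      hc.comp (by fun_prop : Continuous fun w : ℝ × ℝ => (w.1, w.2, t * w.1))
    rw [Measure.volume_eq_prod, lintegral_prod _ hcf.measurable.ennreal_ofReal.aemeasurable,
      ofReal_integral_eq_lintegral_ofReal (hint t) (Eventually.of_forall fun a => (hpos t a).le)]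
    refine lintegral_congr fun a => ?_
    rw [ofReal_integral_eq_lintegral_ofReal (integrable_section hc hp hδ hb _ _)
      (Eventually.of_forall fun b => (hp _ _ _).le)]
  rcases ht.eq_or_lt with rfl | ht
  · exact (min_le_left _ _).trans_eq (by simp)
  rcases ht'.eq_or_lt with rfl | ht'
  · exact (min_le_right _ _).trans_eq (by simp)
  have h0 : 0 < t' - t := by linarith
  have key := busemann_log_concave hc hp hδ hC hb he hl t t' (s := t' / (t' - t))
    (s' := -t / (t' - t)) (by positivity) (div_pos (by linarith) h0) (by field_simp; ring)
  have e0 : t' / (t' - t) * t + -t / (t' - t) * t' = 0 := by field_simp; ring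
  rw [e0] at key
  have hz := hL 0
  simp only [zero_mul] at hz key
  rw [hz, hL, hL]
  rw [← ENNReal.ofReal_min]
  refine ENNReal.ofReal_le_ofReal (le_trans ?_ key)
  set A := ∫ a, ∫ b, f a b (t * a)
  set B := ∫ a, ∫ b, f a b (t' * a)
  have hA : 0 < A := hJ t
  have hB : 0 < B := hJ t'
  have hm : 0 < min A B := lt_min hA hB
  have hs : 0 < t' / (t' - t) := by positivity
  have hs' : 0 < -t / (t' - t) := div_pos (by linarith) h0
  have hss : t' / (t' - t) + -t / (t' - t) = 1 := by field_simp; ring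
  rw [le_div_iff₀ (by positivity)]
  calc min A B * (t' / (t' - t) / A + -t / (t' - t) / B)
      = t' / (t' - t) * (min A B / A) + -t / (t' - t) * (min A B / B) := by ring
    _ ≤ t' / (t' - t) * 1 + -t / (t' - t) * 1 := by
        gcongr
        · exact (div_le_one hA).2 (min_le_left _ _)
        · exact (div_le_one hB).2 (min_le_right _ _)
    _ = 1 := by rw [mul_one, mul_one, hss]

end core

/-! ### The `L^p`-Mahler volume under inclusion and linear maps. -/

section mahler

variable {n : ℕ} {p : ℝ} {K P : Set (EuclideanSpace ℝ (Fin n))}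

theorem integrableOn_exp_inner (hK : IsCompact K) (y : EuclideanSpace ℝ (Fin n)) :
    IntegrableOn (fun x => Real.exp (p * inner ℝ x y)) K :=
  (by fun_prop : Continuous fun x : EuclideanSpace ℝ (Fin n) =>
    Real.exp (p * inner ℝ x y)).continuousOn.integrableOn_compact hK

theorem setIntegral_exp_pos {X : Type*} [MeasurableSpace X] {μ : Measure X} {K : Set X} {g : X → ℝ}
    (hg : IntegrableOn (fun x => Real.exp (g x)) K μ) (h0 : μ K ≠ 0) :
    0 < ∫ x in K, Real.exp (g x) ∂μ := by
  have : NeZero (μ.restrict K) := ⟨by rwa [Ne, Measure.restrict_eq_zero]⟩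
  exact integral_exp_pos hg

theorem volume_real_pos (hK : IsCompact K) (h0 : volume K ≠ 0) : 0 < volume.real K :=
  ENNReal.toReal_pos h0 hK.measure_lt_top.ne

/-- The normalisation by `|K|` does not depend on `y`, so it leaves the integral. The remaining
integrand depends monotonically on `K`. -/
theorem lpMahler_eq (hK : IsCompact K) (h0 : volume K ≠ 0) :
    lpMahler p K = ENNReal.ofReal (volume.real K ^ (1 + 1 / p)) *
      ∫⁻ y, ENNReal.ofReal ((∫ x in K, Real.exp (p * inner ℝ x y)) ^ (-(1 / p))) := by
  have hV := volume_real_pos hK h0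
  have h1 : ∀ y, ENNReal.ofReal (Real.exp (-lpSupport p K y)) = ENNReal.ofReal
      (volume.real K ^ (1 / p)) *
      ENNReal.ofReal ((∫ x in K, Real.exp (p * inner ℝ x y)) ^ (-(1 / p))) := by
    intro y
    have hA := setIntegral_exp_pos (integrableOn_exp_inner (p := p) hK y) h0
    rw [lpSupport, Real.exp_neg, Real.exp_log (Real.rpow_pos_of_pos (div_pos hA hV) _),
      Real.div_rpow hA.le hV.le, ← ENNReal.ofReal_mul (Real.rpow_nonneg hV.le _),
      Real.rpow_neg hA.le]
    congr 1
    field_simp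
  rw [lpMahler]
  simp_rw [h1]
  rw [lintegral_const_mul' _ _ ENNReal.ofReal_ne_top, ← mul_assoc,
    ← ENNReal.ofReal_toReal hK.measure_lt_top.ne, ← ENNReal.ofReal_mul ENNReal.toReal_nonneg,
    Real.rpow_add hV, Real.rpow_one]
  rfl

/-- The integral of the exponential grows with the body and the power `-(1/p)` reverses this, so
only the volume prefactors have to be compared. This takes the place of continuity of `lpMahler` in
the body. -/
theorem lpMahler_mul_le_of_subset (hp : 0 < p) (hK : IsCompact K) (hP : IsCompact P)
    (h0 : volume K ≠ 0) (hKP : K ⊆ P) :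
    lpMahler p P * ENNReal.ofReal ((volume.real K / volume.real P) ^ (1 + 1 / p)) ≤
      lpMahler p K := by
  have h0P : volume P ≠ 0 := fun h => h0 (measure_mono_null hKP h)
  have hVK := volume_real_pos hK h0
  have hVP := volume_real_pos hP h0P
  rw [lpMahler_eq hK h0, lpMahler_eq hP h0P, mul_right_comm,
    ← ENNReal.ofReal_mul (Real.rpow_nonneg hVP.le _), ← Real.mul_rpow hVP.le (by positivity),
    mul_div_cancel₀ _ hVP.ne']
  refine mul_le_mul_right (lintegral_mono fun y => ENNReal.ofReal_le_ofReal ?_) _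
  refine Real.rpow_le_rpow_of_nonpos (setIntegral_exp_pos (integrableOn_exp_inner hK y) h0) ?_
    (by simp; positivity)
  exact setIntegral_mono_set (integrableOn_exp_inner hP y)
    (Eventually.of_forall fun x => (Real.exp_pos _).le) hKP.eventuallyLE

theorem det_adjoint_eq (L : EuclideanSpace ℝ (Fin n) →ₗ[ℝ] EuclideanSpace ℝ (Fin n)) :
    LinearMap.det (LinearMap.adjoint L) = LinearMap.det L := by
  rw [← LinearMap.det_toMatrix (EuclideanSpace.basisFun (Fin n) ℝ).toBasis,
    ← LinearMap.det_toMatrix (EuclideanSpace.basisFun (Fin n) ℝ).toBasis,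
    LinearMap.toMatrix_adjoint, Matrix.det_conjTranspose]
  simp

/-- With `D = |det L|`, the prefactor contributes `D^(1 + 1/p)` and the inner integral `D^(-1/p)`.
The substitution by the adjoint in the outer integral absorbs the remaining `D`. -/
theorem lpMahler_image_linearMap (hK : IsCompact K) (h0 : volume K ≠ 0)
    (L : EuclideanSpace ℝ (Fin n) →ₗ[ℝ] EuclideanSpace ℝ (Fin n)) (hL : LinearMap.det L ≠ 0) :
    lpMahler p (L '' K) = lpMahler p K := by
  set D := |LinearMap.det L| with hD
  have hD0 : 0 < D := abs_pos.2 hL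
  have hinj : ∀ M : EuclideanSpace ℝ (Fin n) →ₗ[ℝ] EuclideanSpace ℝ (Fin n),
      LinearMap.det M ≠ 0 → Function.Bijective M := fun M hM =>
    (LinearEquiv.ofIsUnitDet (v := (EuclideanSpace.basisFun (Fin n) ℝ).toBasis)
      (v' := (EuclideanSpace.basisFun (Fin n) ℝ).toBasis) (f := M)
      (by rw [LinearMap.det_toMatrix]; exact isUnit_iff_ne_zero.2 hM)).bijective
  have hvol : volume.real (L '' K) = D * volume.real K := by
    rw [Measure.real, Measure.addHaar_image_linearMap, ENNReal.toReal_mul,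
      ENNReal.toReal_ofReal (abs_nonneg _)]
    rfl
  have h0' : volume (L '' K) ≠ 0 := by
    rw [Measure.addHaar_image_linearMap]
    exact mul_ne_zero (by simpa using hL) h0
  have hint : ∀ y, ∫ x in L '' K, Real.exp (p * inner ℝ x y) =
      D * ∫ x in K, Real.exp (p * inner ℝ x (LinearMap.adjoint L y)) := by
    intro y
    have := integral_image_eq_integral_abs_det_fderiv_smul volume hK.measurableSet
      (f := L) (f' := fun _ => L.toContinuousLinearMap)
      (fun x _ => L.toContinuousLinearMap.hasFDerivAt.hasFDerivWithinAt)
      (hinj L hL).injective.injOn (fun x => Real.exp (p * inner ℝ x y))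
    rw [this]
    simp only [LinearMap.det_toContinuousLinearMap, smul_eq_mul, LinearMap.adjoint_inner_right]
    exact integral_const_mul _ _
  have hcv : ∀ G : EuclideanSpace ℝ (Fin n) → ℝ≥0∞,
      ∫⁻ y, G y = ENNReal.ofReal D * ∫⁻ y, G (LinearMap.adjoint L y) := by
    intro G
    have hdet : LinearMap.det (LinearMap.adjoint L) ≠ 0 := by rwa [det_adjoint_eq]
    have := lintegral_image_eq_lintegral_abs_det_fderiv_mul volume MeasurableSet.univ
      (f := LinearMap.adjoint L) (f' := fun _ => (LinearMap.adjoint L).toContinuousLinearMap)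
      (fun x _ => (LinearMap.adjoint L).toContinuousLinearMap.hasFDerivAt.hasFDerivWithinAt)
      (hinj _ hdet).injective.injOn G
    rw [image_univ, (hinj _ hdet).surjective.range_eq, setLIntegral_univ, setLIntegral_univ] at this
    rw [this]
    simp only [LinearMap.det_toContinuousLinearMap, det_adjoint_eq]
    exact lintegral_const_mul' _ _ ENNReal.ofReal_ne_top
  rw [lpMahler_eq hK h0, lpMahler_eq (hK.image L.continuous_of_finiteDimensional) h0', hvol]
  simp_rw [hint]
  have hV := volume_real_pos hK h0
  have e : ∀ y, ENNReal.ofReal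
      ((D * ∫ x in K, Real.exp (p * inner ℝ x (LinearMap.adjoint L y))) ^ (-(1 / p))) =
      ENNReal.ofReal (D ^ (-(1 / p))) * ENNReal.ofReal
      ((∫ x in K, Real.exp (p * inner ℝ x (LinearMap.adjoint L y))) ^ (-(1 / p))) := by
    intro y
    rw [Real.mul_rpow hD0.le (integral_nonneg fun x => (Real.exp_pos _).le),
      ENNReal.ofReal_mul (Real.rpow_nonneg hD0.le _)]
  simp_rw [e]
  rw [lintegral_const_mul' _ _ ENNReal.ofReal_ne_top, hcv fun y =>
    ENNReal.ofReal ((∫ x in K, Real.exp (p * inner ℝ x y)) ^ (-(1 / p))), ← mul_assoc, ← mul_assoc,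
    ← ENNReal.ofReal_mul (by positivity), ← ENNReal.ofReal_mul (by positivity)]
  congr 2
  rw [Real.mul_rpow hD0.le hV.le, mul_right_comm, ← Real.rpow_add hD0, mul_comm]
  simp

end mahler

/-! ### Shadow systems in the plane. -/

theorem inner_plane (x y : EuclideanSpace ℝ (Fin 2)) : inner ℝ x y = x 0 * y 0 + x 1 * y 1 := by
  simp [PiLp.inner_apply, Fin.sum_univ_two, mul_comm]

/-- The measurable identification of the Euclidean plane with the product of two lines. -/
noncomputable def planeEquiv : EuclideanSpace ℝ (Fin 2) ≃ᵐ ℝ × ℝ :=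
  (MeasurableEquiv.toLp 2 (Fin 2 → ℝ)).symm.trans MeasurableEquiv.finTwoArrow

theorem planeEquiv_apply (x : EuclideanSpace ℝ (Fin 2)) : planeEquiv x = (x 0, x 1) := rfl

theorem measurePreserving_planeEquiv : MeasurePreserving planeEquiv :=
  (volume_preserving_finTwoArrow ℝ).comp
    (EuclideanSpace.volume_preserving_symm_measurableEquiv_toLp (Fin 2))

theorem lintegral_plane (G : ℝ → ℝ → ℝ≥0∞) :
    ∫⁻ y : EuclideanSpace ℝ (Fin 2), G (y 0) (y 1) = ∫⁻ w : ℝ × ℝ, G w.1 w.2 := by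
  rw [← measurePreserving_planeEquiv.map_eq, lintegral_map_equiv]
  rfl

/-- Log-convexity of exponential integrals. -/
theorem integral_exp_convex {X : Type*} [MeasurableSpace X] {μ : Measure X} {φ ψ : X → ℝ}
    (hφ : Integrable (fun x => Real.exp (φ x)) μ) (hψ : Integrable (fun x => Real.exp (ψ x)) μ)
    {s t : ℝ} (hs : 0 < s) (ht : 0 < t) (hst : s + t = 1)
    (hA : 0 < ∫ x, Real.exp (φ x) ∂μ) (hB : 0 < ∫ x, Real.exp (ψ x) ∂μ) :
    ∫ x, Real.exp (s * φ x + t * ψ x) ∂μ ≤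
      (∫ x, Real.exp (φ x) ∂μ) ^ s * (∫ x, Real.exp (ψ x) ∂μ) ^ t := by
  set A := ∫ x, Real.exp (φ x) ∂μ
  set B := ∫ x, Real.exp (ψ x) ∂μ
  have hpt : ∀ x, Real.exp (s * φ x + t * ψ x) ≤
      A ^ s * B ^ t * (s * (Real.exp (φ x) / A) + t * (Real.exp (ψ x) / B)) := by
    intro x
    have := Real.geom_mean_le_arith_mean2_weighted hs.le ht.le
      (div_nonneg (Real.exp_pos (φ x)).le hA.le) (div_nonneg (Real.exp_pos (ψ x)).le hB.le) hst
    refine le_trans (le_of_eq ?_) (mul_le_mul_of_nonneg_left this (by positivity))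
    rw [Real.div_rpow (Real.exp_pos _).le hA.le, Real.div_rpow (Real.exp_pos _).le hB.le,
      ← Real.exp_mul, ← Real.exp_mul, Real.exp_add, mul_comm (φ x), mul_comm (ψ x)]
    have := (Real.rpow_pos_of_pos hA s).ne'
    have := (Real.rpow_pos_of_pos hB t).ne'
    field_simp
  have hi : Integrable (fun x => A ^ s * B ^ t *
      (s * (Real.exp (φ x) / A) + t * (Real.exp (ψ x) / B))) μ :=
    (((hφ.div_const A).const_mul s).add ((hψ.div_const B).const_mul t)).const_mul _
  refine (integral_mono_of_nonneg (Eventually.of_forall fun x => (Real.exp_pos _).le) hi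
    (Eventually.of_forall hpt)).trans_eq ?_
  rw [integral_const_mul, integral_add ((hφ.div_const A).const_mul s)
    ((hψ.div_const B).const_mul t), integral_const_mul, integral_const_mul, integral_div,
    integral_div, div_self hA.ne', div_self hB.ne', mul_one, mul_one, hst, mul_one]

/-- Exponential integrals over a neighbourhood of the origin grow exponentially, as long as the
extra exponent vanishes near the origin. -/
theorem exists_exp_le_integral {p : ℝ} (hp : 0 < p) {K : Set (EuclideanSpace ℝ (Fin 2))}
    (hK : IsCompact K) (h0 : (0 : EuclideanSpace ℝ (Fin 2)) ∈ interior K) {h : ℝ} (hh : 0 < h)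
    {α : ℝ → ℝ} (hα : Continuous α) (hαz : ∀ s, |s| ≤ h → α s = 0) :
    ∃ c δ : ℝ, 0 < c ∧ 0 < δ ∧ ∀ a b z : ℝ, c * (Real.exp (δ * |a|) * Real.exp (δ * |b|)) ≤
      ∫ x in K, Real.exp (p * (x 0 * a + x 1 * b + α (x 1) * z)) := by
  obtain ⟨ε, hε, hball⟩ := Metric.mem_nhds_iff.1 (mem_interior_iff_mem_nhds.1 h0)
  -- Only a ball of radius `r` around `(±2r, ±2r)` is used. Its points have coordinates at most `3r`
  -- in size, so they lie in the `ε`-ball and in the strip where `α` vanishes.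
  set r := min ε h / 8 with hr
  have hr0 : 0 < r := by positivity
  have hrε : 8 * r ≤ ε := by rw [hr]; linarith [min_le_left ε h]
  have hrh : 8 * r ≤ h := by rw [hr]; linarith [min_le_right ε h]
  refine ⟨volume.real (Metric.ball (0 : EuclideanSpace ℝ (Fin 2)) r), p * r,
    ENNReal.toReal_pos (Metric.measure_ball_pos _ _ hr0).ne' measure_ball_lt_top.ne,
    by positivity, fun a b z => ?_⟩
  -- The signs of the centre are those of `a` and `b`, so that `x 0 * a ≥ r * |a|` and `x 1 * b ≥ r
  -- * |b|` on the whole ball.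
  have hs : ∀ a : ℝ, ∃ u : ℝ, |u| = 2 * r ∧ u * a = 2 * r * |a| := by
    intro a
    rcases le_total 0 a with ha | ha
    · exact ⟨2 * r, abs_of_pos (by positivity), by rw [abs_of_nonneg ha]⟩
    · exact ⟨-(2 * r), by rw [abs_neg, abs_of_pos (by positivity)], by
        rw [abs_of_nonpos ha]; ring⟩
  obtain ⟨u, hu, hua⟩ := hs a
  obtain ⟨v, hv, hvb⟩ := hs b
  set y : EuclideanSpace ℝ (Fin 2) := !₂[u, v] with hy
  have hcoord : ∀ x ∈ Metric.ball y r, |x 0 - u| < r ∧ |x 1 - v| < r := by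
    intro x hx
    rw [Metric.mem_ball, dist_eq_norm] at hx
    have h1 := (PiLp.norm_apply_le (x - y) 0).trans_lt hx
    have h2 := (PiLp.norm_apply_le (x - y) 1).trans_lt hx
    simpa [hy] using And.intro h1 h2
  have hsub : Metric.ball y r ⊆ K := by
    intro x hx
    apply hball
    obtain ⟨h1, h2⟩ := hcoord x hx
    rw [Metric.mem_ball, dist_zero_right, EuclideanSpace.norm_eq, Fin.sum_univ_two]
    rw [Real.sqrt_lt' hε]
    simp only [Real.norm_eq_abs]
    have e1 : |x 0| ≤ 3 * r := by
      have := abs_add_le (x 0 - u) u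
      rw [sub_add_cancel] at this
      linarith
    have e2 : |x 1| ≤ 3 * r := by
      have := abs_add_le (x 1 - v) v
      rw [sub_add_cancel] at this
      linarith
    nlinarith [abs_nonneg (x 0), abs_nonneg (x 1)]
  have hcont : Continuous fun x : EuclideanSpace ℝ (Fin 2) =>
      Real.exp (p * (x 0 * a + x 1 * b + α (x 1) * z)) := by fun_prop
  have hint : IntegrableOn (fun x : EuclideanSpace ℝ (Fin 2) =>
      Real.exp (p * (x 0 * a + x 1 * b + α (x 1) * z))) K :=
    hcont.continuousOn.integrableOn_compact hK
  calc volume.real (Metric.ball (0 : EuclideanSpace ℝ (Fin 2)) r) *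
        (Real.exp (p * r * |a|) * Real.exp (p * r * |b|))
      = ∫ x in Metric.ball y r, Real.exp (p * r * |a|) * Real.exp (p * r * |b|) := by
        rw [setIntegral_const, smul_eq_mul, Measure.real, Measure.real,
          Measure.addHaar_ball_center volume y]
    _ ≤ ∫ x in Metric.ball y r, Real.exp (p * (x 0 * a + x 1 * b + α (x 1) * z)) := by
        refine setIntegral_mono_on (integrableOn_const measure_ball_lt_top.ne)
          (hint.mono_set hsub) Metric.isOpen_ball.measurableSet fun x hx => ?_
        obtain ⟨h1, h2⟩ := hcoord x hx
        have e2 : |x 1| ≤ 3 * r := by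
          have := abs_add_le (x 1 - v) v
          rw [sub_add_cancel] at this
          linarith
        rw [hαz _ (by linarith), zero_mul, add_zero, ← Real.exp_add]
        apply Real.exp_le_exp.2
        have k1 : r * |a| ≤ x 0 * a := by
          have : |(x 0 - u) * a| ≤ r * |a| := by
            rw [abs_mul]; exact mul_le_mul_of_nonneg_right h1.le (abs_nonneg _)
          have := (abs_le.1 this).1
          nlinarith
        have k2 : r * |b| ≤ x 1 * b := by
          have : |(x 1 - v) * b| ≤ r * |b| := by
            rw [abs_mul]; exact mul_le_mul_of_nonneg_right h2.le (abs_nonneg _)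
          have := (abs_le.1 this).1
          nlinarith
        nlinarith
    _ ≤ _ := setIntegral_mono_set hint (Eventually.of_forall fun x => (Real.exp_pos _).le)
        hsub.eventuallyLE

/-- Along a shadow system of a symmetric planar body, moving in the first coordinate direction,
the `L^p`-Mahler volume is at least its minimum over the two end bodies. -/
theorem min_lpMahler_le_of_shadow {p : ℝ} (hp : 0 < p) {K K₁ K₂ : Set (EuclideanSpace ℝ (Fin 2))}
    (hK : IsCompact K) (hK₁ : IsCompact K₁) (hK₂ : IsCompact K₂) (hsymm : ∀ x ∈ K, -x ∈ K)
    (h0 : (0 : EuclideanSpace ℝ (Fin 2)) ∈ interior K) {h : ℝ} (hh : 0 < h)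
    {α : ℝ → ℝ} (hα : Continuous α) (hαz : ∀ s, |s| ≤ h → α s = 0) (hαo : ∀ s, α (-s) = -α s)
    {t₁ t₂ : ℝ} (ht₁ : t₁ ≤ 0) (ht₂ : 0 ≤ t₂)
    (H₁ : ∀ a b : ℝ, ∫ x in K₁, Real.exp (p * (x 0 * a + x 1 * b)) =
      ∫ x in K, Real.exp (p * (x 0 * a + x 1 * b + α (x 1) * (t₁ * a))))
    (H₂ : ∀ a b : ℝ, ∫ x in K₂, Real.exp (p * (x 0 * a + x 1 * b)) =
      ∫ x in K, Real.exp (p * (x 0 * a + x 1 * b + α (x 1) * (t₂ * a)))) :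
    min (lpMahler p K₁) (lpMahler p K₂) ≤ lpMahler p K := by
  obtain ⟨c, δ, hc, hδ, hlow⟩ := exists_exp_le_integral hp hK h0 hh hα hαz
  have hvol : ∀ K' : Set (EuclideanSpace ℝ (Fin 2)), ∀ t : ℝ,
      (∀ a b : ℝ, ∫ x in K', Real.exp (p * (x 0 * a + x 1 * b)) =
      ∫ x in K, Real.exp (p * (x 0 * a + x 1 * b + α (x 1) * (t * a)))) →
      volume.real K' = volume.real K := by
    intro K' t H
    -- At `a = b = 0` the identity compares areas.
    have := H 0 0
    simpa using this
  have hK0 : volume K ≠ 0 := fun h => by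
    have := hlow 0 0 0
    rw [Measure.restrict_eq_zero.2 h] at this
    simp at this
    linarith
  have hV := volume_real_pos hK hK0
  have hne : ∀ K' : Set (EuclideanSpace ℝ (Fin 2)), volume.real K' = volume.real K →
      volume K' ≠ 0 := by
    intro K' h h'
    rw [← h, Measure.real, h'] at hV
    simp at hV
  have hv₁ := hvol K₁ t₁ H₁
  have hv₂ := hvol K₂ t₂ H₂
  rw [lpMahler_eq hK hK0, lpMahler_eq hK₁ (hne _ hv₁), lpMahler_eq hK₂ (hne _ hv₂), hv₁, hv₂,
    ← mul_min]
  refine mul_le_mul_right ?_ _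
  set Z : ℝ → ℝ → ℝ → ℝ := fun a b z =>
    ∫ x in K, Real.exp (p * (x 0 * a + x 1 * b + α (x 1) * z)) with hZ
  have hint : ∀ a b z : ℝ, IntegrableOn (fun x : EuclideanSpace ℝ (Fin 2) =>
      Real.exp (p * (x 0 * a + x 1 * b + α (x 1) * z))) K := fun a b z =>
    (by fun_prop : Continuous fun x : EuclideanSpace ℝ (Fin 2) =>
      Real.exp (p * (x 0 * a + x 1 * b + α (x 1) * z))).continuousOn.integrableOn_compact hK
  have hZp : ∀ a b z, 0 < Z a b z := fun a b z => setIntegral_exp_pos (hint a b z) hK0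
  have hZc : Continuous fun w : ℝ × ℝ × ℝ => Z w.1 w.2.1 w.2.2 := by
    refine continuous_parametric_integral_of_continuous ?_ hK
    fun_prop
  have hZe : ∀ a b z, Z (-a) (-b) (-z) = Z a b z := by
    intro a b z
    have hKn : (fun x => -x) ⁻¹' K = K := by
      ext x
      exact ⟨fun h => by simpa using hsymm _ h, fun h => hsymm _ h⟩
    have := (Measure.measurePreserving_neg (volume : Measure (EuclideanSpace ℝ (Fin 2)))).setIntegral_preimage_emb
      (MeasurableEquiv.neg _).measurableEmbedding
      (fun x => Real.exp (p * (x 0 * a + x 1 * b + α (x 1) * z))) K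
    rw [hKn] at this
    simp only [hZ]
    rw [← this]
    refine integral_congr_ae (Eventually.of_forall fun x => ?_)
    simp only [PiLp.neg_apply, hαo]
    ring_nf
  have hq : 0 < 1 / p := by positivity
  -- The lower bound on `Z`, uniform in `z`, gives the exponential decay of `Z^(-1/p)`, and
  -- log-convexity of `Z` gives its log-concavity.
  have key := min_le_lintegral_plane (f := fun a b z => Z a b z ^ (-(1 / p)))
    (C := c ^ (-(1 / p))) (δ := δ * (1 / p))
    (hZc.rpow_const fun w => Or.inl (hZp _ _ _).ne') (fun a b z => Real.rpow_pos_of_pos (hZp a b z) _)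
    (by positivity) (by positivity) (fun a b z => by
      refine (Real.rpow_le_rpow_of_nonpos (by positivity) (hlow a b z) (by linarith)).trans_eq ?_
      rw [Real.mul_rpow hc.le (by positivity), Real.mul_rpow (by positivity) (by positivity),
        ← Real.exp_mul, ← Real.exp_mul]
      ring_nf)
    (fun a b z => by rw [hZe]) (fun a b z a' b' z' s t hs ht hst => by
      rw [← Real.rpow_mul (hZp _ _ _).le, ← Real.rpow_mul (hZp _ _ _).le, mul_comm _ s, mul_comm _ t,
        Real.rpow_mul (hZp _ _ _).le, Real.rpow_mul (hZp _ _ _).le,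
        ← Real.mul_rpow (Real.rpow_nonneg (hZp _ _ _).le _) (Real.rpow_nonneg (hZp _ _ _).le _)]
      refine Real.rpow_le_rpow_of_nonpos (hZp _ _ _) ?_ (by linarith)
      refine le_trans (le_of_eq ?_) (integral_exp_convex (hint a b z) (hint a' b' z') hs ht hst
        (hZp _ _ _) (hZp _ _ _))
      refine integral_congr_ae (Eventually.of_forall fun x => ?_)
      simp only
      ring_nf) ht₁ ht₂
  have e0 : ∫⁻ y, ENNReal.ofReal ((∫ x in K, Real.exp (p * inner ℝ x y)) ^ (-(1 / p))) =
      ∫⁻ w : ℝ × ℝ, ENNReal.ofReal (Z w.1 w.2 0 ^ (-(1 / p))) := by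
    rw [← lintegral_plane fun a b => ENNReal.ofReal (Z a b 0 ^ (-(1 / p)))]
    simp only [hZ, inner_plane, mul_zero, add_zero]
  have e : ∀ K' : Set (EuclideanSpace ℝ (Fin 2)), ∀ t : ℝ,
      (∀ a b : ℝ, ∫ x in K', Real.exp (p * (x 0 * a + x 1 * b)) =
      ∫ x in K, Real.exp (p * (x 0 * a + x 1 * b + α (x 1) * (t * a)))) →
      ∫⁻ y, ENNReal.ofReal ((∫ x in K', Real.exp (p * inner ℝ x y)) ^ (-(1 / p))) =
      ∫⁻ w : ℝ × ℝ, ENNReal.ofReal (Z w.1 w.2 (t * w.1) ^ (-(1 / p))) := by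
    intro K' t H
    rw [← lintegral_plane fun a b => ENNReal.ofReal (Z a b (t * a) ^ (-(1 / p)))]
    simp only [hZ, inner_plane, H]
  rw [e0, e K₁ t₁ H₁, e K₂ t₂ H₂]
  exact key

/-! ### Convex hulls and shears in the plane. -/

theorem plane_ext {x y : EuclideanSpace ℝ (Fin 2)} (h0 : x 0 = y 0) (h1 : x 1 = y 1) : x = y := by
  ext i
  fin_cases i
  · exact h0
  · exact h1

theorem convex_halfplane (a b c : ℝ) :
    Convex ℝ {x : EuclideanSpace ℝ (Fin 2) | a * x 0 + b * x 1 ≤ c} := by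
  intro x hx y hy s t hs ht hst
  simp only [mem_ofPred_eq, PiLp.add_apply, PiLp.smul_apply, smul_eq_mul] at *
  calc _ = s * (a * x 0 + b * x 1) + t * (a * y 0 + b * y 1) := by ring
    _ ≤ s * c + t * c := by gcongr
    _ = c := by rw [← add_mul, hst, one_mul]

theorem convex_combination_three {D : Set (EuclideanSpace ℝ (Fin 2))} (hD : Convex ℝ D) {a b c : ℝ}
    (ha : 0 ≤ a) (hb : 0 ≤ b) (hc : 0 ≤ c) (habc : a + b + c = 1)
    {x y z : EuclideanSpace ℝ (Fin 2)} (hx : x ∈ D) (hy : y ∈ D) (hz : z ∈ D) :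
    a • x + b • y + c • z ∈ D := by
  have := hD.sum_mem (t := Finset.univ) (w := ![a, b, c]) (z := ![x, y, z])
    (by intro i _; fin_cases i <;> simpa) (by simpa [Fin.sum_univ_three] using habc)
    (by intro i _; fin_cases i <;> simpa)
  simpa [Fin.sum_univ_three] using this

theorem neg_mem_convexHull {S : Set (EuclideanSpace ℝ (Fin 2))} (hS : ∀ x ∈ S, -x ∈ S) :
    ∀ x ∈ convexHull ℝ S, -x ∈ convexHull ℝ S := by
  intro x hx
  have hSn : -S = S := by
    ext y
    exact ⟨fun h => by simpa using hS _ h, fun h => hS _ h⟩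
  rw [← Set.mem_neg, ← convexHull_neg, hSn]
  exact hx

theorem zero_mem_convexHull {S : Set (EuclideanSpace ℝ (Fin 2))} {x : EuclideanSpace ℝ (Fin 2)}
    (hx : x ∈ S) (hx' : -x ∈ S) : (0 : EuclideanSpace ℝ (Fin 2)) ∈ convexHull ℝ S := by
  have := convex_convexHull ℝ S (subset_convexHull ℝ S hx) (subset_convexHull ℝ S hx')
    (a := 1 / 2) (b := 1 / 2) (by norm_num) (by norm_num) (by norm_num)
  simpa using this

/-- The odd piecewise linear profile vanishing on `[-h, h]` and equal to `1` at `1`. -/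
noncomputable def profile (h s : ℝ) : ℝ := (max (s - h) 0 - max (-s - h) 0) / (1 - h)

theorem continuous_profile (h : ℝ) : Continuous (profile h) := by
  unfold profile; fun_prop

theorem profile_of_abs_le {h s : ℝ} (hs : |s| ≤ h) : profile h s = 0 := by
  obtain ⟨h1, h2⟩ := abs_le.1 hs
  rw [profile, max_eq_right (by linarith), max_eq_right (by linarith), sub_zero, zero_div]

theorem profile_neg (h s : ℝ) : profile h (-s) = -profile h s := by
  rw [profile, profile, neg_neg, ← neg_div, neg_sub]

theorem profile_of_le {h s : ℝ} (h0 : 0 ≤ h) (hs : h ≤ s) : profile h s = (s - h) / (1 - h) := by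
  rw [profile, max_eq_left (by linarith), max_eq_right (by linarith), sub_zero]

/-- The shear of the plane along the first axis with the given profile. -/
noncomputable def shear (h t : ℝ) (x : EuclideanSpace ℝ (Fin 2)) : EuclideanSpace ℝ (Fin 2) :=
  !₂[x 0 + t * profile h (x 1), x 1]

@[simp] theorem shear_apply_zero (h t : ℝ) (x : EuclideanSpace ℝ (Fin 2)) :
    shear h t x 0 = x 0 + t * profile h (x 1) := rfl

@[simp] theorem shear_apply_one (h t : ℝ) (x : EuclideanSpace ℝ (Fin 2)) :
    shear h t x 1 = x 1 := rfl

theorem shear_neg_apply (h t : ℝ) (x : EuclideanSpace ℝ (Fin 2)) :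
    shear h t (-x) = -shear h t x := by
  refine plane_ext ?_ (by simp)
  simp [profile_neg]
  ring

theorem shear_shear (h s t : ℝ) (x : EuclideanSpace ℝ (Fin 2)) :
    shear h s (shear h t x) = shear h (t + s) x := by
  refine plane_ext ?_ (by simp)
  simp
  ring

theorem shear_zero (h : ℝ) (x : EuclideanSpace ℝ (Fin 2)) : shear h 0 x = x :=
  plane_ext (by simp) (by simp)

theorem continuous_shear (h t : ℝ) : Continuous (shear h t) := by
  have := continuous_profile h
  refine (PiLp.continuous_toLp 2 _).comp (continuous_pi fun i => ?_)
  fin_cases i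
  · simp; fun_prop
  · simp; fun_prop

theorem injective_shear (h t : ℝ) : Function.Injective (shear h t) := by
  intro x y hxy
  have := congrArg (shear h (-t)) hxy
  simpa [shear_shear, shear_zero] using this

/-- With the coordinates swapped, a shear is a skew product of the identity with translations. -/
theorem measurePreserving_shear (h t : ℝ) : MeasurePreserving (shear h t) := by
  have hp := (continuous_profile h).measurable
  have h1 : MeasurePreserving (fun w : ℝ × ℝ => (w.1, w.2 + t * profile h w.1))
      (volume.prod volume) (volume.prod volume) := by
    refine (MeasurePreserving.id volume).skew_product (g := fun s a => a + t * profile h s)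
      (by fun_prop) (Eventually.of_forall fun s => ?_)
    exact (measurePreserving_add_right volume (t * profile h s)).map_eq
  have h2 : MeasurePreserving (Prod.swap : ℝ × ℝ → ℝ × ℝ) (volume.prod volume)
      (volume.prod volume) := Measure.measurePreserving_swap
  have h3 := (measurePreserving_planeEquiv.symm planeEquiv).comp
    ((h2.comp (h1.comp h2)).comp measurePreserving_planeEquiv)
  convert h3 using 1
  funext x
  apply planeEquiv.injective
  simp [planeEquiv_apply]

theorem measurableEmbedding_shear (h t : ℝ) : MeasurableEmbedding (shear h t) :=
  (continuous_shear h t).measurableEmbedding (injective_shear h t)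

theorem setIntegral_shear_image (h t : ℝ) (K : Set (EuclideanSpace ℝ (Fin 2)))
    (g : EuclideanSpace ℝ (Fin 2) → ℝ) :
    ∫ x in shear h t '' K, g x = ∫ x in K, g (shear h t x) :=
  (measurePreserving_shear h t).setIntegral_image_emb (measurableEmbedding_shear h t) g K

theorem volume_shear_image (h t : ℝ) (K : Set (EuclideanSpace ℝ (Fin 2))) :
    volume (shear h t '' K) = volume K := by
  rw [← (measurePreserving_shear h t).measure_preimage_emb (measurableEmbedding_shear h t),
    preimage_image_eq _ (injective_shear h t)]

/-! ### Moving an antipodal pair of apexes over a symmetric set. -/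

/-- For `σ = ±1`: the point `q` lies on the inner side of the line through the apex `(t, 1)` and
the shoulder point `(σ X, h)`. -/
def InnerSide (σ X h t : ℝ) (q : EuclideanSpace ℝ (Fin 2)) : Prop :=
  (σ * q 0 - X) * (1 - h) ≤ (X - σ * t) * (h - q 1)

theorem convex_innerSide (σ X h t : ℝ) : Convex ℝ {q | InnerSide σ X h t q} := by
  convert convex_halfplane (σ * (1 - h)) (X - σ * t) (X * (1 - h) + (X - σ * t) * h) using 3
  rw [InnerSide]
  constructor <;> intro h <;> linarith

/-- A symmetric set `A` with shoulder points `(-X', h)`, `(X, h)`, lying below the level `h` and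
within the angle at the apex `(t, 1)` spanned by the shoulder points. -/
structure Capped (A : Set (EuclideanSpace ℝ (Fin 2))) (X X' h t : ℝ) : Prop where
  symm : ∀ x ∈ A, -x ∈ A
  right_mem : !₂[X, h] ∈ A
  left_mem : !₂[-X', h] ∈ A
  right_pos : 0 < X
  left_pos : 0 < X'
  lt_one : h < 1
  le_level : ∀ q ∈ A, q 1 ≤ h
  right_side : ∀ q ∈ A, InnerSide 1 X h t q
  left_side : ∀ q ∈ A, InnerSide (-1) X' h t q

/-- The symmetric hull of `A` and the apexes `±(t, 1)`. -/
def cappedHull (A : Set (EuclideanSpace ℝ (Fin 2))) (t : ℝ) : Set (EuclideanSpace ℝ (Fin 2)) :=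
  convexHull ℝ (A ∪ {!₂[t, 1], -!₂[t, 1]})

namespace Capped

variable {A : Set (EuclideanSpace ℝ (Fin 2))} {X X' h t : ℝ} {x : EuclideanSpace ℝ (Fin 2)}

theorem level_nonneg (H : Capped A X X' h t) : 0 ≤ h := by
  have := H.le_level _ (H.symm _ H.right_mem)
  simp at this
  linarith

theorem neg_mem (H : Capped A X X' h t) : ∀ x ∈ cappedHull A t, -x ∈ cappedHull A t := by
  refine neg_mem_convexHull fun x hx => ?_
  rcases hx with hx | rfl | rfl
  · exact Or.inl (H.symm x hx)
  · exact Or.inr (by simp)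
  · exact Or.inr (by simp)

theorem side_of_mem (H : Capped A X X' h t) (hx : x ∈ cappedHull A t) :
    InnerSide 1 X h t x ∧ InnerSide (-1) X' h t x := by
  have hc := (convex_innerSide 1 X h t).inter (convex_innerSide (-1) X' h t)
  -- The antipodes of the shoulders give `h t ≤ X` and `-h t ≤ X'`, which is what places the lower
  -- apex `-(t, 1)` on the inner sides.
  have h1 := H.right_side _ (H.symm _ H.right_mem)
  have h2 := H.left_side _ (H.symm _ H.left_mem)
  have := H.lt_one
  have := H.right_pos
  have := H.left_pos
  refine convexHull_min ?_ hc hx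
  rintro y (hy | rfl | rfl)
  · exact ⟨H.right_side y hy, H.left_side y hy⟩
  · simp only [InnerSide, mem_inter_iff, mem_ofPred_eq]
    simp
    constructor <;> linarith
  · simp only [InnerSide, mem_inter_iff, mem_ofPred_eq] at *
    simp at *
    constructor <;> linarith

/-- Points of the hull above the shoulder level lie in the top triangle. -/
theorem exists_weights (H : Capped A X X' h t) (hx : x ∈ cappedHull A t) (hh : h ≤ x 1) :
    ∃ a b c : ℝ, 0 ≤ a ∧ 0 ≤ b ∧ 0 ≤ c ∧ a + b + c = 1 ∧
      x 0 = a * X - b * X' + c * t ∧ x 1 = (a + b) * h + c := by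
  obtain ⟨h1, h2⟩ := H.side_of_mem hx
  have hl := H.lt_one
  have hX := H.right_pos
  have hX' := H.left_pos
  simp only [InnerSide] at h1 h2
  have hh1 : 0 < 1 - h := by linarith
  have hXX : 0 < X + X' := by linarith
  obtain ⟨c, hc⟩ : ∃ c, c = (x 1 - h) / (1 - h) := ⟨_, rfl⟩
  have hc' : c * (1 - h) = x 1 - h := by rw [hc]; field_simp
  have hc0 : 0 ≤ c := by rw [hc]; exact div_nonneg (by linarith) hh1.le
  -- The height fixes the apex weight `c`. The two side conditions are then exactly nonnegativity of
  -- the two shoulder weights.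
  have k1 : x 0 - X ≤ -(X - t) * c := by
    refine le_of_mul_le_mul_right ?_ hh1
    rw [mul_assoc, hc']
    linarith
  have k2 : -(x 0) - X' ≤ -(X' + t) * c := by
    refine le_of_mul_le_mul_right ?_ hh1
    rw [mul_assoc, hc']
    linarith
  refine ⟨(x 0 - c * t + (1 - c) * X') / (X + X'), ((1 - c) * X - x 0 + c * t) / (X + X'), c,
    div_nonneg (by linarith) hXX.le, div_nonneg (by linarith) hXX.le, hc0, ?_, ?_, ?_⟩
  · field_simp; ring
  · field_simp; ring
  · have e : (x 0 - c * t + (1 - c) * X') / (X + X') + ((1 - c) * X - x 0 + c * t) / (X + X') =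
        1 - c := by field_simp; ring
    rw [e]; linarith

theorem mem_convexHull_of_level_eq (H : Capped A X X' h t) (hx : x ∈ cappedHull A t)
    (hh : x 1 = h) : x ∈ convexHull ℝ A := by
  obtain ⟨a, b, c, ha, hb, hc, habc, e0, e1⟩ := H.exists_weights hx hh.ge
  have hl := H.lt_one
  have hc0 : c = 0 := by
    have : c * (1 - h) = 0 := by
      rw [hh] at e1
      have : a + b = 1 - c := by linarith
      rw [this] at e1
      linarith
    rcases mul_eq_zero.1 this with h | h
    · exact h
    · linarith
  subst hc0
  have := convex_convexHull ℝ A (subset_convexHull ℝ A H.right_mem)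
    (subset_convexHull ℝ A H.left_mem) ha hb (by linarith)
  convert this using 1
  refine plane_ext ?_ ?_
  · simp [e0]; ring
  · simp [e1]; ring

theorem zero_mem (H : Capped A X X' h t) : (0 : EuclideanSpace ℝ (Fin 2)) ∈ convexHull ℝ A :=
  zero_mem_convexHull H.right_mem (H.symm _ H.right_mem)

theorem level_le_of_mem (H : Capped A X X' h t) (hx : x ∈ convexHull ℝ A) : x 1 ≤ h := by
  have := convexHull_min (t := {x : EuclideanSpace ℝ (Fin 2) | 0 * x 0 + 1 * x 1 ≤ h})
    (fun y hy => by simpa using H.le_level y hy) (convex_halfplane _ _ _) hx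
  simpa using this

/-- The segment from `q` to the apex meets level `h` between the shoulders, hence in the hull of
`A`. Its part below that level joins two points of the hull. -/
theorem mem_convexHull_of_segment (H : Capped A X X' h t) {q : EuclideanSpace ℝ (Fin 2)}
    (hq : q ∈ convexHull ℝ A) {μ : ℝ} (hμ0 : 0 ≤ μ)
    (hμ : (1 - μ) * q 1 + μ ≤ h) :
    (1 - μ) • q + μ • !₂[t, 1] ∈ convexHull ℝ A := by
  have hqh := H.level_le_of_mem hq
  have hl := H.lt_one
  rcases hμ0.eq_or_lt with rfl | hμ0
  · simpa using hq
  have hq1 : 0 < 1 - q 1 := by linarith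
  have hqlt : 0 < h - q 1 := by nlinarith
  set ν := (h - q 1) / (1 - q 1) with hν
  have hν0 : 0 < ν := by positivity
  have hν1 : ν < 1 := by rw [hν, div_lt_one hq1]; linarith
  have hνe : ν * (1 - q 1) = h - q 1 := by rw [hν]; field_simp
  have hμν : μ ≤ ν := by rw [hν, le_div_iff₀ hq1]; linarith
  have hy : (1 - ν) • q + ν • !₂[t, 1] ∈ cappedHull A t := by
    refine convex_convexHull ℝ _ (convexHull_mono subset_union_left hq)
      (subset_convexHull ℝ _ (Or.inr (by simp))) (by linarith) hν0.le (by ring)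
  have hyA := H.mem_convexHull_of_level_eq hy (by simp; linarith)
  have := convex_convexHull ℝ A hq hyA (a := 1 - μ / ν) (b := μ / ν)
    (sub_nonneg.2 ((div_le_one hν0).2 hμν)) (by positivity) (by ring)
  convert this using 1
  refine plane_ext ?_ ?_
  · simp; field_simp; ring
  · simp; field_simp; ring

/-- Since `0` lies in the hull of `A`, the missing weight `1 - a - μ` can be absorbed by shrinking
`q`. -/
theorem mem_convexHull_of_join (H : Capped A X X' h t) {q : EuclideanSpace ℝ (Fin 2)}
    (hq : q ∈ convexHull ℝ A) {a μ : ℝ} (ha : 0 ≤ a) (hμ0 : 0 ≤ μ) (haμ : a + μ ≤ 1)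
    (hμ : a * q 1 + μ ≤ h) :
    a • q + μ • !₂[t, 1] ∈ convexHull ℝ A := by
  have hl := H.lt_one
  rcases (show μ ≤ 1 by linarith).eq_or_lt with rfl | h1
  · have : a = 0 := by linarith
    subst this
    linarith
  have h1' : 0 < 1 - μ := by linarith
  have hq' : (a / (1 - μ)) • q ∈ convexHull ℝ A :=
    (convex_convexHull ℝ A).smul_mem_of_zero_mem H.zero_mem hq
      ⟨by positivity, (div_le_one h1').2 (by linarith)⟩
  have := H.mem_convexHull_of_segment hq' hμ0 (by simp; field_simp; linarith)
  rwa [smul_smul, mul_div_cancel₀ _ h1'.ne'] at this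

/-- Points of the hull between the two shoulder levels lie in the hull of `A`. -/
theorem mem_convexHull_of_abs_le (H : Capped A X X' h t) (hx : x ∈ cappedHull A t)
    (hh : |x 1| ≤ h) : x ∈ convexHull ℝ A := by
  obtain ⟨hh1, hh2⟩ := abs_le.1 hh
  rw [cappedHull, convexHull_union ⟨_, H.right_mem⟩ (by simp), mem_convexJoin] at hx
  obtain ⟨q, hq, m, hm, a, b, ha, hb, hab, rfl⟩ := hx
  rw [convexHull_pair] at hm
  obtain ⟨c, d, hc, hd, hcd, rfl⟩ := hm
  rcases le_total d c with hdc | hdc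
  · have := H.mem_convexHull_of_join hq (a := a) (μ := b * (c - d)) ha
      (mul_nonneg hb (by linarith)) (by nlinarith) (by simp at hh2; linarith)
    convert this using 1
    refine plane_ext ?_ ?_
    · simp; ring
    · simp; ring
  · have hq' := neg_mem_convexHull H.symm _ hq
    have := neg_mem_convexHull H.symm _ (H.mem_convexHull_of_join hq' (a := a) (μ := b * (d - c)) ha
      (mul_nonneg hb (by linarith)) (by nlinarith) (by simp at hh1 ⊢; linarith))
    convert this using 1
    refine plane_ext ?_ ?_
    · simp; ring
    · simp; ring

/-- On the top triangle the profile equals the barycentric weight of the apex, so the shear only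
replaces the apex by its translate. The bottom triangle follows by symmetry, and the middle part
lies in the hull of `A` and is fixed. -/
theorem shear_mem (H : Capped A X X' h t) (hx : x ∈ cappedHull A t) (s : ℝ) :
    shear h s x ∈ cappedHull A (t + s) := by
  have hh := H.level_nonneg
  have hl := H.lt_one
  have hup : ∀ x ∈ cappedHull A t, h ≤ x 1 → shear h s x ∈ cappedHull A (t + s) := by
    intro x hx hx1
    obtain ⟨a, b, c, ha, hb, hc, habc, e0, e1⟩ := H.exists_weights hx hx1
    have hsub : A ∪ {!₂[t + s, 1], -!₂[t + s, 1]} ⊆ cappedHull A (t + s) := subset_convexHull ℝ _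
    have hp : profile h (x 1) = c := by
      rw [profile_of_le hh hx1, div_eq_iff (by linarith), e1]
      have : a + b = 1 - c := by linarith
      rw [this]; ring
    have : _ ∈ cappedHull A (t + s) := convex_combination_three (convex_convexHull ℝ _) ha hb hc
      habc (hsub (Or.inl H.right_mem)) (hsub (Or.inl H.left_mem)) (hsub (Or.inr (by simp : !₂[t + s, 1] ∈ _)))
    convert this using 1
    refine plane_ext ?_ ?_
    · simp [hp, e0]; ring
    · simp [e1]; ring
  rcases le_total h (x 1) with h1 | h1
  · exact hup x hx h1
  rcases le_total (x 1) (-h) with h2 | h2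
  · have := hup (-x) (H.neg_mem x hx) (by simp; linarith)
    rw [shear_neg_apply] at this
    refine (neg_neg (shear h s x)) ▸ ?_
    refine neg_mem_convexHull (fun x hx => ?_) _ this
    rcases hx with hx | rfl | rfl
    · exact Or.inl (H.symm x hx)
    · exact Or.inr (by simp)
    · exact Or.inr (by simp)
  · have habs : |x 1| ≤ h := abs_le.2 ⟨h2, h1⟩
    have : shear h s x = x := plane_ext (by simp [profile_of_abs_le habs]) (by simp)
    rw [this]
    exact convexHull_mono subset_union_left (H.mem_convexHull_of_abs_le hx habs)

theorem shear_image {s : ℝ} (H : Capped A X X' h t) (H' : Capped A X X' h (t + s)) :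
    shear h s '' cappedHull A t = cappedHull A (t + s) := by
  apply Subset.antisymm
  · rintro _ ⟨x, hx, rfl⟩
    exact H.shear_mem hx s
  · intro x hx
    refine ⟨shear h (-s) x, ?_, by simp [shear_shear, shear_zero]⟩
    simpa using H'.shear_mem hx (-s)

end Capped

/-- If `w = a (-w) + b y`, then `w = (b / (1 + a)) y` lies between `0` and `y`. Thus `-w` may be
used when showing that the pair `±w` is redundant. -/
theorem mem_convexHull_of_mem_insert_neg {B : Set (EuclideanSpace ℝ (Fin 2))}
    {w : EuclideanSpace ℝ (Fin 2)} (h0 : (0 : EuclideanSpace ℝ (Fin 2)) ∈ convexHull ℝ B)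
    (hw : w ∈ convexHull ℝ (insert (-w) B)) : w ∈ convexHull ℝ B := by
  have hB : B.Nonempty := convexHull_nonempty_iff.1 ⟨0, h0⟩
  rw [convexHull_insert hB, mem_convexJoin] at hw
  obtain ⟨z, hz, y, hy, a, b, ha, hb, hab, e⟩ := hw
  rw [mem_singleton_iff.1 hz] at e
  have h1 : (1 + a) • w = b • y := by
    rw [add_smul, one_smul]
    nth_rewrite 1 [← e]
    rw [smul_neg]
    abel
  have h2 : w = (b / (1 + a)) • y := by
    rw [div_eq_inv_mul, ← smul_smul, ← h1, smul_smul, inv_mul_cancel₀ (by positivity), one_smul]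
  rw [h2]
  exact (convex_convexHull ℝ B).smul_mem_of_zero_mem h0 hy
    ⟨by positivity, (div_le_one (by positivity)).2 (by linarith)⟩

/-- Dropping a redundant antipodal pair does not change the hull. -/
theorem convexHull_diff_pair {S : Set (EuclideanSpace ℝ (Fin 2))} (hS : ∀ x ∈ S, -x ∈ S)
    {w : EuclideanSpace ℝ (Fin 2)} (hw : w ∈ convexHull ℝ (S \ {w, -w})) :
    convexHull ℝ (S \ {w, -w}) = convexHull ℝ S := by
  have hS' : ∀ x ∈ S \ {w, -w}, -x ∈ S \ {w, -w} := by
    rintro x ⟨hx, hx'⟩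
    refine ⟨hS x hx, fun h => hx' ?_⟩
    rcases h with h | h
    · exact Or.inr (by rw [mem_singleton_iff, ← h, neg_neg])
    · exact Or.inl (neg_injective h)
  apply Subset.antisymm (convexHull_mono sdiff_subset)
  refine convexHull_min (fun x hx => ?_) (convex_convexHull ℝ _)
  by_cases h : x ∈ ({w, -w} : Set (EuclideanSpace ℝ (Fin 2)))
  · rcases h with rfl | rfl
    · exact hw
    · exact neg_mem_convexHull hS' _ hw
  · exact subset_convexHull ℝ _ ⟨hx, h⟩

namespace Capped

variable {A : Set (EuclideanSpace ℝ (Fin 2))} {X X' h t : ℝ} {x : EuclideanSpace ℝ (Fin 2)}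

/-- The largest displacement of the apex in direction `σ = ±1` that keeps `A` on the inner side. -/
theorem exists_extremal_displacement (hA : A.Finite) (hsymm : ∀ x ∈ A, -x ∈ A) {σ : ℝ} (hσ : σ * σ = 1)
    (hX : !₂[σ * X, h] ∈ A) (h0 : 0 < h) (h1 : h < 1) (hle : ∀ q ∈ A, q 1 ≤ h)
    (hR : ∀ q ∈ A, InnerSide σ X h 0 q) (hL : ∀ q ∈ A, InnerSide (-σ) X' h 0 q) :
    ∃ t, 0 ≤ σ * t ∧ (∀ q ∈ A, InnerSide σ X h t q) ∧ (∀ q ∈ A, InnerSide (-σ) X' h t q) ∧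
      ∃ q ∈ A, q 1 < h ∧ !₂[σ * X, h] ∈ segment ℝ q !₂[t, 1] := by
  have hh1 : 0 < 1 - h := by linarith
  set B := {q ∈ A | q 1 < h} with hB
  have hBf : B.Finite := hA.subset (sep_subset _ _)
  have hBn : B.Nonempty := ⟨_, hsymm _ hX, by simp; linarith⟩
  -- `τ q` is the value of `σ t` at which `q` reaches the line through the apex and the shoulder.
  -- Points at level `h` impose no condition on `t`.
  set τ : EuclideanSpace ℝ (Fin 2) → ℝ := fun q => X - (σ * q 0 - X) * (1 - h) / (h - q 1) with hτ
  obtain ⟨q, ⟨hqA, hqh⟩, hqmin⟩ := exists_min_image B τ hBf hBn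
  have hσt : σ * (σ * τ q) = τ q := by rw [← mul_assoc, hσ, one_mul]
  have hqh' : 0 < h - q 1 := by linarith
  have hτ0 : 0 ≤ τ q := by
    have := hR q hqA
    rw [InnerSide, mul_zero, sub_zero] at this
    rw [hτ, sub_nonneg, div_le_iff₀ hqh']
    exact this
  have hτe : (X - τ q) * (h - q 1) = (σ * q 0 - X) * (1 - h) := by
    rw [hτ]; field_simp; ring
  refine ⟨σ * τ q, by rw [hσt]; exact hτ0, fun r hr => ?_, fun r hr => ?_, q, hqA, hqh, ?_⟩
  · rw [InnerSide, hσt]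
    rcases (hle r hr).eq_or_lt with hrh | hrh
    · have := hR r hr
      rw [InnerSide, hrh, sub_self, mul_zero] at this
      rw [hrh, sub_self, mul_zero]
      exact this
    · have h2 : τ q ≤ τ r := hqmin r ⟨hr, hrh⟩
      have h3 : (X - τ r) * (h - r 1) = (σ * r 0 - X) * (1 - h) := by
        have : 0 < h - r 1 := by linarith
        rw [hτ]; field_simp; ring
      rw [← h3]
      exact mul_le_mul_of_nonneg_right (by linarith) (by linarith)
  · have := hL r hr
    rw [InnerSide, mul_zero, sub_zero] at this
    have e : -σ * (σ * τ q) = -τ q := by rw [neg_mul, hσt]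
    rw [InnerSide, e]
    -- The apex moves away from the opposite side line, whose condition only becomes weaker.
    exact this.trans (mul_le_mul_of_nonneg_right (by linarith) (by linarith [hle r hr]))
  · have hq1 : 0 < 1 - q 1 := by linarith
    refine ⟨(1 - h) / (1 - q 1), (h - q 1) / (1 - q 1), by positivity, by positivity,
      by field_simp; ring, ?_⟩
    have e : σ * ((X - τ q) * (h - q 1)) = (σ * σ * q 0 - σ * X) * (1 - h) := by rw [hτe]; ring
    rw [hσ] at e
    refine plane_ext ?_ ?_
    · simp
      field_simp
      linarith
    · simp
      field_simp
      ring

/-- Here `w` is the shoulder that has become redundant. The bound `A.ncard + 2` counts `A` together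
with two distinct apexes. -/
theorem exists_fewer_points {w : EuclideanSpace ℝ (Fin 2)} (hA : A.Finite)
    (hsymm : ∀ x ∈ A, -x ∈ A) (hw : w ∈ A) {q : EuclideanSpace ℝ (Fin 2)} (hq : q ∈ A) (hqw : q ≠ w)
    (hseg : w ∈ segment ℝ q !₂[t, 1]) :
    ∃ S : Set (EuclideanSpace ℝ (Fin 2)), S.Finite ∧ (∀ x ∈ S, -x ∈ S) ∧
      S.ncard < A.ncard + 2 ∧ convexHull ℝ S = cappedHull A t := by
  -- If `w` is itself an apex, both apexes already belong to `A` and nothing has to be removed.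
  by_cases hwv : w ∈ ({!₂[t, 1], -!₂[t, 1]} : Set (EuclideanSpace ℝ (Fin 2)))
  · refine ⟨A ∪ {!₂[t, 1], -!₂[t, 1]}, hA.union (by simp), ?_, ?_, rfl⟩
    · rintro x (hx | rfl | rfl)
      · exact Or.inl (hsymm x hx)
      · exact Or.inr (by simp)
      · exact Or.inr (by simp)
    · have hmem : !₂[t, 1] ∈ A ∧ -!₂[t, 1] ∈ A := by
        rcases hwv with rfl | rfl
        · exact ⟨hw, hsymm _ hw⟩
        · exact ⟨by simpa using hsymm _ hw, hw⟩
      have : A ∪ {!₂[t, 1], -!₂[t, 1]} = A := union_eq_left.2 (by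
        rintro x (rfl | rfl)
        · exact hmem.1
        · exact hmem.2)
      rw [this]
      omega
  set T := A ∪ {!₂[t, 1], -!₂[t, 1]} with hT
  have hTs : ∀ x ∈ T, -x ∈ T := by
    rintro x (hx | rfl | rfl)
    · exact Or.inl (hsymm x hx)
    · exact Or.inr (by simp)
    · exact Or.inr (by simp)
  have hTf : T.Finite := hA.union (by simp)
  have hv : !₂[t, 1] ∈ T \ {w, -w} := by
    refine ⟨Or.inr (by simp), fun h => hwv ?_⟩
    rcases h with h | h
    · exact Or.inl h.symm
    · exact Or.inr (by rw [mem_singleton_iff] at h ⊢; rw [h, neg_neg])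
  have hv' : -!₂[t, 1] ∈ T \ {w, -w} := by
    refine ⟨Or.inr (by simp), fun h => hwv ?_⟩
    rcases h with h | h
    · exact Or.inr h.symm
    · exact Or.inl (neg_injective h).symm
  have hmem : w ∈ convexHull ℝ (T \ {w, -w}) := by
    refine mem_convexHull_of_mem_insert_neg (zero_mem_convexHull hv hv') ?_
    have hq' : q ∈ insert (-w) (T \ {w, -w}) := by
      by_cases h : q = -w
      · exact Or.inl h
      · exact Or.inr ⟨Or.inl hq, by simp [hqw, h]⟩
    exact segment_subset_convexHull hq' (mem_insert_of_mem _ hv) hseg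
  refine ⟨T \ {w, -w}, hTf.subset sdiff_subset, ?_, ?_, convexHull_diff_pair hTs hmem⟩
  · rintro x ⟨hx, hx'⟩
    refine ⟨hTs x hx, fun h => hx' ?_⟩
    rcases h with h | h
    · exact Or.inr (by rw [mem_singleton_iff, ← h, neg_neg])
    · exact Or.inl (neg_injective h)
  · calc (T \ {w, -w}).ncard < T.ncard :=
          ncard_lt_ncard ⟨sdiff_subset, fun h => (h (Or.inl hw : w ∈ T)).2 (by simp)⟩ hTf
      _ ≤ A.ncard + ({!₂[t, 1], -!₂[t, 1]} : Set (EuclideanSpace ℝ (Fin 2))).ncard :=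
          ncard_union_le _ _
      _ ≤ A.ncard + 2 := by 
          gcongr
          exact (ncard_insert_le _ _).trans (by simp)

/-- Shearing by `s` adds `s * profile h (x 1)` to `x 0`, which amounts to putting `z = s a` in the
third variable of the shadow system. -/
theorem setIntegral_cappedHull {p s : ℝ} (H : Capped A X X' h 0) (H' : Capped A X X' h s) (a b : ℝ) :
    ∫ x in cappedHull A s, Real.exp (p * (x 0 * a + x 1 * b)) =
      ∫ x in cappedHull A 0, Real.exp (p * (x 0 * a + x 1 * b + profile h (x 1) * (s * a))) := by
  have := H.shear_image (s := s) (by rwa [zero_add])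
  rw [zero_add] at this
  rw [← this, setIntegral_shear_image]
  refine integral_congr_ae (Eventually.of_forall fun x => ?_)
  simp only [shear_apply_zero, shear_apply_one]
  ring_nf

/-- Moving the apex to both extremal positions removes a pair of vertices and does not increase
the smaller of the two `L^p`-Mahler volumes. -/
theorem exists_fewer_min_lpMahler_le {p : ℝ} (hp : 0 < p) (hA : A.Finite) (H : Capped A X X' h 0)
    (h0 : 0 < h) (hint : (0 : EuclideanSpace ℝ (Fin 2)) ∈ interior (cappedHull A 0)) :
    ∃ S₁ S₂ : Set (EuclideanSpace ℝ (Fin 2)),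
      (S₁.Finite ∧ (∀ x ∈ S₁, -x ∈ S₁) ∧ S₁.ncard < A.ncard + 2 ∧ volume (convexHull ℝ S₁) ≠ 0) ∧
      (S₂.Finite ∧ (∀ x ∈ S₂, -x ∈ S₂) ∧ S₂.ncard < A.ncard + 2 ∧ volume (convexHull ℝ S₂) ≠ 0) ∧
      min (lpMahler p (convexHull ℝ S₁)) (lpMahler p (convexHull ℝ S₂)) ≤
        lpMahler p (cappedHull A 0) := by
  obtain ⟨t₂, ht₂, hR₂, hL₂, q₂, hq₂, hqh₂, hs₂⟩ := exists_extremal_displacement (X := X) (X' := X')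
    hA H.symm (σ := 1) (by norm_num) (by simpa using H.right_mem) h0 H.lt_one
    H.le_level H.right_side H.left_side
  obtain ⟨t₁, ht₁, hL₁, hR₁, q₁, hq₁, hqh₁, hs₁⟩ := exists_extremal_displacement (X := X') (X' := X)
    hA H.symm (σ := -1) (by norm_num) (by simpa using H.left_mem) h0 H.lt_one
    H.le_level H.left_side (by simpa using H.right_side)
  rw [neg_neg] at hR₁
  have H₁ : Capped A X X' h t₁ := { H with right_side := hR₁, left_side := hL₁ }
  have H₂ : Capped A X X' h t₂ := { H with right_side := hR₂, left_side := hL₂ }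
  obtain ⟨S₁, hf₁, hsy₁, hc₁, he₁⟩ := exists_fewer_points hA H.symm (w := !₂[-1 * X', h])
    (by simpa using H.left_mem) hq₁ (fun e => by rw [e] at hqh₁; simp at hqh₁) hs₁
  obtain ⟨S₂, hf₂, hsy₂, hc₂, he₂⟩ := exists_fewer_points hA H.symm (w := !₂[1 * X, h])
    (by simpa using H.right_mem) hq₂ (fun e => by rw [e] at hqh₂; simp at hqh₂) hs₂
  have hcomp : ∀ s, IsCompact (cappedHull A s) := fun s => (hA.union (toFinite _)).isCompact_convexHull ℝ
  have hvol : volume (cappedHull A 0) ≠ 0 := fun h => by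
    have := isOpen_interior.measure_pos volume ⟨_, hint⟩
    exact this.ne' (measure_mono_null interior_subset h)
  have hvt : ∀ s, Capped A X X' h s → volume (cappedHull A s) ≠ 0 := by
    intro s Hs
    have := H.shear_image (s := s) (by rwa [zero_add])
    rw [zero_add] at this
    rwa [← this, volume_shear_image]
  refine ⟨S₁, S₂, ⟨hf₁, hsy₁, hc₁, by rw [he₁]; exact hvt _ H₁⟩,
    ⟨hf₂, hsy₂, hc₂, by rw [he₂]; exact hvt _ H₂⟩, ?_⟩
  rw [he₁, he₂]
  exact min_lpMahler_le_of_shadow hp (hcomp _) (hcomp _) (hcomp _) H.neg_mem hint h0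
    (continuous_profile h) (fun s => profile_of_abs_le) (profile_neg h) (by linarith) (by linarith)
    (setIntegral_cappedHull H H₁) (setIntegral_cappedHull H H₂)

end Capped

/-! ### Minimal symmetric point sets and their linear normal form. -/

/-- The linear map of the plane with matrix rows `(a, b)` and `(c, d)`. -/
noncomputable def planeMap (a b c d : ℝ) : EuclideanSpace ℝ (Fin 2) →ₗ[ℝ] EuclideanSpace ℝ (Fin 2) where
  toFun x := !₂[a * x 0 + b * x 1, c * x 0 + d * x 1]
  map_add' x y := plane_ext (by simp; ring) (by simp; ring)
  map_smul' r x := plane_ext (by simp; ring) (by simp; ring)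

theorem planeMap_apply (a b c d : ℝ) (x : EuclideanSpace ℝ (Fin 2)) :
    planeMap a b c d x = !₂[a * x 0 + b * x 1, c * x 0 + d * x 1] := rfl

theorem injective_planeMap {a b c d : ℝ} (h : a * d - b * c ≠ 0) :
    Function.Injective (planeMap a b c d) := by
  rw [injective_iff_map_eq_zero]
  intro x hx
  have h0 : a * x 0 + b * x 1 = 0 := by simpa [planeMap_apply] using congrArg (fun z => z 0) hx
  have h1 : c * x 0 + d * x 1 = 0 := by simpa [planeMap_apply] using congrArg (fun z => z 1) hx
  refine plane_ext ?_ ?_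
  · have : (a * d - b * c) * x 0 = 0 := by linear_combination d * h0 - b * h1
    simpa [h] using this
  · have : (a * d - b * c) * x 1 = 0 := by linear_combination a * h1 - c * h0
    simpa [h] using this

theorem det_ne_zero_of_injective {L : EuclideanSpace ℝ (Fin 2) →ₗ[ℝ] EuclideanSpace ℝ (Fin 2)}
    (hL : Function.Injective L) : LinearMap.det L ≠ 0 := by
  intro h
  have := LinearMap.bot_lt_ker_of_det_eq_zero h
  rw [LinearMap.ker_eq_bot.2 hL] at this
  exact lt_irrefl _ this

theorem exists_mem_not_on_line {S : Set (EuclideanSpace ℝ (Fin 2))}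
    (hvol : volume (convexHull ℝ S) ≠ 0) {a b : ℝ} (hab : a ≠ 0 ∨ b ≠ 0) :
    ∃ w ∈ S, a * w 0 + b * w 1 ≠ 0 := by
  by_contra! hcon
  apply hvol
  -- Otherwise the hull lies in the kernel of a nonzero functional, a null set. The zero second row
  -- makes the functional an endomorphism.
  have hker : convexHull ℝ S ⊆ LinearMap.ker (planeMap a b 0 0) := by
    refine convexHull_min (fun x hx => ?_) (Submodule.convex _)
    have := hcon x hx
    simp only [SetLike.mem_coe, LinearMap.mem_ker, planeMap_apply]
    exact plane_ext (by simpa using this) (by simp)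
  refine measure_mono_null hker (Measure.addHaar_submodule volume _ fun htop => ?_)
  have : !₂[a, b] ∈ LinearMap.ker (planeMap a b 0 0) := htop ▸ Submodule.mem_top
  rw [LinearMap.mem_ker, planeMap_apply] at this
  have := congrArg (fun z => z 0) this
  simp at this
  rcases hab with h | h
  · have := mul_self_pos.2 h; nlinarith [mul_self_nonneg b]
  · have := mul_self_pos.2 h; nlinarith [mul_self_nonneg a]

theorem neg_mem_diff_pair {S : Set (EuclideanSpace ℝ (Fin 2))} (hS : ∀ x ∈ S, -x ∈ S)
    {w : EuclideanSpace ℝ (Fin 2)} : ∀ x ∈ S \ {w, -w}, -x ∈ S \ {w, -w} := by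
  rintro x ⟨hx, hx'⟩
  refine ⟨hS x hx, fun h => hx' ?_⟩
  rcases h with h | h
  · exact Or.inr (by rw [mem_singleton_iff, ← h, neg_neg])
  · exact Or.inl (neg_injective h)

/-- A symmetric finite set none of whose antipodal pairs is redundant for its convex hull. -/
structure IsMinimalSymm (S : Set (EuclideanSpace ℝ (Fin 2))) : Prop where
  finite : S.Finite
  symm : ∀ x ∈ S, -x ∈ S
  not_mem : ∀ w ∈ S, w ∉ convexHull ℝ (S \ {w, -w})

theorem IsMinimalSymm.image {S : Set (EuclideanSpace ℝ (Fin 2))} (hS : IsMinimalSymm S)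
    {L : EuclideanSpace ℝ (Fin 2) →ₗ[ℝ] EuclideanSpace ℝ (Fin 2)} (hL : Function.Injective L) :
    IsMinimalSymm (L '' S) := by
  refine ⟨hS.finite.image _, ?_, ?_⟩
  · rintro _ ⟨x, hx, rfl⟩
    exact ⟨-x, hS.symm x hx, map_neg L x⟩
  · rintro _ ⟨w, hw, rfl⟩ hmem
    have : (L '' S) \ {L w, -L w} = L '' (S \ {w, -w}) := by
      rw [image_sdiff hL, image_pair, map_neg]
    rw [this, ← LinearMap.image_convexHull] at hmem
    obtain ⟨x, hx, hxw⟩ := hmem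
    exact hS.not_mem w hw (hL hxw ▸ hx)

/-- A point of a minimal set off the line through another one, up to sign. -/
theorem IsMinimalSymm.det_ne_zero {S : Set (EuclideanSpace ℝ (Fin 2))} (hS : IsMinimalSymm S)
    {v w : EuclideanSpace ℝ (Fin 2)} (hv : v ∈ S) (hv0 : v ≠ 0) (hw : w ∈ S) (hwv : w ≠ v)
    (hwv' : w ≠ -v) : -v 1 * w 0 + v 0 * w 1 ≠ 0 := by
  intro hd
  have hN : 0 < v 0 * v 0 + v 1 * v 1 := by
    rcases eq_or_ne (v 0) 0 with h | h
    · have h1 : v 1 ≠ 0 := fun h1 => hv0 (plane_ext h h1)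
      have := mul_self_pos.2 h1
      nlinarith [mul_self_nonneg (v 0)]
    · have := mul_self_pos.2 h
      nlinarith [mul_self_nonneg (v 1)]
  obtain ⟨c, hc⟩ : ∃ c, c = (v 0 * w 0 + v 1 * w 1) / (v 0 * v 0 + v 1 * v 1) := ⟨_, rfl⟩
  have hc' : c * (v 0 * v 0 + v 1 * v 1) = v 0 * w 0 + v 1 * w 1 := by
    rw [hc, div_mul_cancel₀ _ hN.ne']
  have hwc : w = c • v := by
    refine plane_ext ?_ ?_
    · simp only [PiLp.smul_apply, smul_eq_mul]
      apply mul_left_cancel₀ hN.ne'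
      linear_combination -v 1 * hd - v 0 * hc'
    · simp only [PiLp.smul_apply, smul_eq_mul]
      apply mul_left_cancel₀ hN.ne'
      linear_combination v 0 * hd - v 1 * hc'
  -- Of two parallel points, the shorter is a convex combination of the longer and its negative,
  -- contradicting minimality.
  have key : ∀ x y : EuclideanSpace ℝ (Fin 2), x ∈ S → y ∈ S → y ≠ x → y ≠ -x →
      ∀ c : ℝ, |c| ≤ 1 → x ≠ c • y := by
    intro x y hx hy hyx hyx' c hc hxy
    apply hS.not_mem x hx
    have hyd : y ∈ S \ {x, -x} := ⟨hy, by simp [hyx, hyx']⟩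
    have hyd' := neg_mem_diff_pair hS.symm y hyd
    obtain ⟨h1, h2⟩ := abs_le.1 hc
    have := convex_convexHull ℝ _ (subset_convexHull ℝ _ hyd) (subset_convexHull ℝ _ hyd')
      (a := (1 + c) / 2) (b := (1 - c) / 2) (by linarith) (by linarith) (by ring)
    convert this using 1
    rw [hxy, smul_neg, ← sub_eq_add_neg, ← sub_smul]
    congr 1
    ring
  rcases le_total |c| 1 with h | h
  · exact key w v hw hv hwv.symm (fun e => hwv' (by rw [e, neg_neg])) c h hwc
  · have hc0 : c ≠ 0 := by
      rintro rfl
      norm_num at h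
    refine key v w hv hw hwv hwv' c⁻¹ (by rw [abs_inv]; exact inv_le_one_of_one_le₀ h) ?_
    rw [hwc, smul_smul, inv_mul_cancel₀ hc0, one_smul]

/-- Linear normal form: some vertex goes to `(0, 1)`, and the remaining points lie below the level
of two shoulder points on either side of it. -/
theorem IsMinimalSymm.exists_normal_form {S : Set (EuclideanSpace ℝ (Fin 2))} (hS : IsMinimalSymm S)
    (hvol : volume (convexHull ℝ S) ≠ 0) :
    ∃ L : EuclideanSpace ℝ (Fin 2) →ₗ[ℝ] EuclideanSpace ℝ (Fin 2), Function.Injective L ∧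
      ∃ X X' h : ℝ, 0 < X ∧ 0 < X' ∧ !₂[0, 1] ∈ L '' S ∧ !₂[X, h] ∈ L '' S ∧ !₂[-X', h] ∈ L '' S ∧
        ∀ q ∈ L '' S, q ≠ !₂[0, 1] → q ≠ -!₂[0, 1] → q 1 ≤ h := by
  obtain ⟨v, hv, hv0⟩ := exists_mem_not_on_line hvol (a := 1) (b := 0) (by norm_num)
  have hv0' : v ≠ 0 := by
    rintro rfl
    simp at hv0
  have hv0 : v 0 ≠ 0 := by simpa using hv0
  have hN : 0 < v 0 * v 0 + v 1 * v 1 := by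
    have := mul_self_pos.2 hv0
    nlinarith [mul_self_nonneg (v 1)]
  set d : EuclideanSpace ℝ (Fin 2) → ℝ := fun x => -v 1 * x 0 + v 0 * x 1 with hd
  set σ : EuclideanSpace ℝ (Fin 2) → ℝ := fun x =>
    (v 0 * x 0 + v 1 * x 1) / (v 0 * v 0 + v 1 * v 1) with hσ
  have hdn : ∀ x, d (-x) = -d x := fun x => by simp [hd]; ring
  have hdv : d v = 0 := by simp [hd]; ring
  have hfin : {x ∈ S | d x < 0}.Finite := hS.finite.subset (sep_subset _ _)
  have hfin' : {x ∈ S | 0 < d x}.Finite := hS.finite.subset (sep_subset _ _)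
  obtain ⟨w, hw, hwd⟩ := exists_mem_not_on_line hvol (a := -v 1) (b := v 0) (Or.inr hv0)
  have hne : ({x ∈ S | d x < 0} ×ˢ {x ∈ S | 0 < d x}).Nonempty := by
    rcases lt_or_gt_of_ne hwd with h | h
    · exact ⟨(w, -w), ⟨hw, h⟩, hS.symm w hw, by rw [hdn]; exact neg_pos.2 h⟩
    · exact ⟨(-w, w), ⟨hS.symm w hw, by rw [hdn]; exact neg_lt_zero.2 h⟩, hw, h⟩
  -- The quotient is the height at which the chord from `w₁` to `w₂` crosses the line through `v`. A
  -- chord with highest crossing has no point of `S` other than `±v` above its line. Adding `κ d` to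
  -- the height makes this chord horizontal.
  obtain ⟨⟨w₁, w₂⟩, ⟨⟨hw₁, hd₁⟩, hw₂, hd₂⟩, hmax⟩ := exists_max_image _
    (fun w : EuclideanSpace ℝ (Fin 2) × EuclideanSpace ℝ (Fin 2) =>
      (d w.2 * σ w.1 - d w.1 * σ w.2) / (d w.2 - d w.1)) (hfin.prod hfin') hne
  simp only at hw₁ hd₁ hw₂ hd₂ hmax
  have hd12 : 0 < d w₂ - d w₁ := by linarith
  obtain ⟨κ, hκ⟩ : ∃ κ, κ = (σ w₁ - σ w₂) / (d w₂ - d w₁) := ⟨_, rfl⟩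
  obtain ⟨h, hh⟩ : ∃ h, h = (d w₂ * σ w₁ - d w₁ * σ w₂) / (d w₂ - d w₁) := ⟨_, rfl⟩
  have hκ' : κ * (d w₂ - d w₁) = σ w₁ - σ w₂ := by rw [hκ]; field_simp
  have e1 : σ w₁ + κ * d w₁ = h := by rw [hh, hκ]; field_simp; ring
  have e2 : σ w₂ + κ * d w₂ = h := by rw [hh, hκ]; field_simp; ring
  have hL : ∀ x, planeMap (-v 1) (v 0) (v 0 / (v 0 * v 0 + v 1 * v 1) - κ * v 1)
      (v 1 / (v 0 * v 0 + v 1 * v 1) + κ * v 0) x = !₂[d x, σ x + κ * d x] := by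
    intro x
    rw [planeMap_apply]
    refine plane_ext rfl ?_
    simp [hd, hσ]
    ring
  refine ⟨planeMap (-v 1) (v 0) (v 0 / (v 0 * v 0 + v 1 * v 1) - κ * v 1)
      (v 1 / (v 0 * v 0 + v 1 * v 1) + κ * v 0), injective_planeMap ?_, d w₂, -d w₁, h, hd₂,
      by linarith, ⟨v, hv, ?_⟩, ⟨w₂, hw₂, ?_⟩, ⟨w₁, hw₁, ?_⟩, ?_⟩
  · have : -v 1 * (v 1 / (v 0 * v 0 + v 1 * v 1) + κ * v 0) -
        v 0 * (v 0 / (v 0 * v 0 + v 1 * v 1) - κ * v 1) = -1 := by field_simp; ring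
    rw [this]; norm_num
  · rw [hL, hdv]
    have : σ v = 1 := div_self hN.ne'
    rw [this]
    simp
  · rw [hL, e2]
  · rw [hL, e1, neg_neg]
  · rintro _ ⟨q, hq, rfl⟩ hq1 hq2
    have hLv : planeMap (-v 1) (v 0) (v 0 / (v 0 * v 0 + v 1 * v 1) - κ * v 1)
        (v 1 / (v 0 * v 0 + v 1 * v 1) + κ * v 0) v = !₂[0, 1] := by
      rw [hL, hdv]
      have : σ v = 1 := div_self hN.ne'
      rw [this]
      simp
    have hqd : d q ≠ 0 := hS.det_ne_zero hv hv0' hq (fun e => hq1 (by rw [e, hLv]))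
      (fun e => hq2 (by rw [e, map_neg, hLv]))
    rw [hL]
    change σ q + κ * d q ≤ h
    rcases lt_or_gt_of_ne hqd with hneg | hpos
    · have := hmax (q, w₂) ⟨⟨hq, hneg⟩, hw₂, hd₂⟩
      simp only at this
      rw [← hh, div_le_iff₀ (by linarith)] at this
      have e3 : σ w₂ = h - κ * d w₂ := by linarith
      rw [e3] at this
      have : d w₂ * (σ q + κ * d q) ≤ d w₂ * h := by linarith
      exact le_of_mul_le_mul_left this hd₂
    · have := hmax (w₁, q) ⟨⟨hw₁, hd₁⟩, hq, hpos⟩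
      simp only at this
      rw [← hh, div_le_iff₀ (by linarith)] at this
      have e3 : σ w₁ = h - κ * d w₁ := by linarith
      rw [e3] at this
      have : -d w₁ * (σ q + κ * d q) ≤ -d w₁ * h := by linarith
      exact le_of_mul_le_mul_left this (by linarith)

/-- If `q` were outside, the segment from `q` to the apex would cross level `h` beyond the shoulder
`w`. Then `w` would lie between that crossing, at `σ Y`, and the other shoulder, so it would be
redundant. -/
theorem IsMinimalSymm.innerSide {S : Set (EuclideanSpace ℝ (Fin 2))} (hS : IsMinimalSymm S)
    (hv : !₂[0, 1] ∈ S) {σ X X' h : ℝ} (hσ : σ * σ = 1) (hX : 0 < X) (hX' : 0 < X') (h1 : h < 1)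
    (hw : !₂[σ * X, h] ∈ S) (hw' : !₂[-σ * X', h] ∈ S) {q : EuclideanSpace ℝ (Fin 2)} (hq : q ∈ S)
    (hqh : q 1 ≤ h) : InnerSide σ X h 0 q := by
  by_contra hcon
  rw [InnerSide, mul_zero, sub_zero, not_le] at hcon
  have hσ0 : σ ≠ 0 := by
    rintro rfl
    norm_num at hσ
  have hq1 : 0 < 1 - q 1 := by linarith
  obtain ⟨Y, hY⟩ : ∃ Y, Y = (1 - h) * (σ * q 0) / (1 - q 1) := ⟨_, rfl⟩
  have hY' : Y * (1 - q 1) = (1 - h) * (σ * q 0) := by rw [hY]; field_simp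
  have hXY : X < Y := by
    rw [hY, lt_div_iff₀ hq1]
    linarith
  obtain ⟨μ, hμ⟩ : ∃ μ, μ = (X + X') / (Y + X') := ⟨_, rfl⟩
  have hYX : 0 < Y + X' := by linarith
  have hμ' : μ * (Y + X') = X + X' := by rw [hμ]; field_simp
  have hμ0 : 0 ≤ μ := by rw [hμ]; positivity
  have hμ1 : μ ≤ 1 := by rw [hμ, div_le_one hYX]; linarith
  set w : EuclideanSpace ℝ (Fin 2) := !₂[σ * X, h] with hwdef
  have hins : ∀ x ∈ S, x ≠ w → x ∈ insert (-w) (S \ {w, -w}) := by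
    intro x hx hxw
    by_cases h : x = -w
    · exact Or.inl h
    · exact Or.inr ⟨hx, by simp [hxw, h]⟩
  have hσX : σ * X ≠ 0 := mul_ne_zero hσ0 hX.ne'
  have hvw : !₂[0, 1] ≠ w := fun e => hσX (by simpa [hwdef] using (congrArg (fun z => z 0) e).symm)
  have hvw' : !₂[0, 1] ≠ -w := fun e => hσX (by simpa [hwdef] using (congrArg (fun z => z 0) e).symm)
  have hw'w : !₂[-σ * X', h] ≠ w := fun e => by
    have : -σ * X' = σ * X := congrArg (fun z => z 0) e
    have : σ * (X + X') = 0 := by linarith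
    rcases mul_eq_zero.1 this with h | h
    · exact hσ0 h
    · linarith
  have hqw : q ≠ w := fun e => by
    rw [e] at hcon
    simp only [hwdef] at hcon
    simp [← mul_assoc, hσ] at hcon
  have hvd : !₂[0, 1] ∈ S \ {w, -w} := ⟨hv, by simp [hvw, hvw']⟩
  refine hS.not_mem w hw (mem_convexHull_of_mem_insert_neg
    (zero_mem_convexHull hvd (neg_mem_diff_pair hS.symm _ hvd)) ?_)
  have := convex_combination_three (convex_convexHull ℝ _)
    (a := μ * ((1 - h) / (1 - q 1))) (b := μ * ((h - q 1) / (1 - q 1))) (c := 1 - μ)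
    (mul_nonneg hμ0 (div_nonneg (by linarith) hq1.le))
    (mul_nonneg hμ0 (div_nonneg (by linarith) hq1.le)) (by linarith) (by field_simp; ring)
    (subset_convexHull ℝ _ (hins q hq hqw)) (subset_convexHull ℝ _ (hins _ hv hvw))
    (subset_convexHull ℝ _ (hins _ hw' hw'w))
  convert this using 1
  refine plane_ext ?_ ?_
  · have e : q 0 * (1 - h) / (1 - q 1) = σ * Y := by
      rw [hY]
      linear_combination (-(q 0 * (1 - h) / (1 - q 1))) * hσ
    simp [hwdef]
    linear_combination -μ * e - σ * hμ'
  · simp [hwdef]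
    field_simp
    ring

theorem IsMinimalSymm.capped {S : Set (EuclideanSpace ℝ (Fin 2))} (hS : IsMinimalSymm S)
    {X X' h : ℝ} (hX : 0 < X) (hX' : 0 < X') (hv : !₂[0, 1] ∈ S) (hw : !₂[X, h] ∈ S)
    (hw' : !₂[-X', h] ∈ S) (hle : ∀ q ∈ S, q ≠ !₂[0, 1] → q ≠ -!₂[0, 1] → q 1 ≤ h) :
    Capped (S \ {!₂[0, 1], -!₂[0, 1]}) X X' h 0 := by
  have hle' : ∀ q ∈ S \ {!₂[0, 1], -!₂[0, 1]}, q 1 ≤ h := by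
    rintro q ⟨hq, hq'⟩
    simp only [mem_insert_iff, mem_singleton_iff, not_or] at hq'
    exact hle q hq hq'.1 hq'.2
  have hmem : ∀ a : ℝ, a ≠ 0 → !₂[a, h] ∈ S → !₂[a, h] ∈ S \ {!₂[0, 1], -!₂[0, 1]} := by
    intro a ha hs
    refine ⟨hs, ?_⟩
    rintro (e | e)
    · exact ha (congrArg (fun z => z 0) e)
    · exact ha (by simpa using congrArg (fun z => z 0) (mem_singleton_iff.1 e))
  have hwA := hmem X hX.ne' hw
  have hwA' := hmem (-X') (by linarith) hw'
  have hsymm := neg_mem_diff_pair hS.symm (w := !₂[0, 1])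
  -- If `h ≥ 1`, the chord of the shoulders contains `(0, h)`, and shrinking it by `1 / h` would
  -- make the apex redundant.
  have h1 : h < 1 := by
    by_contra! h1
    apply hS.not_mem _ hv
    have hXX : 0 < X + X' := by linarith
    have hc := convex_convexHull ℝ _ (subset_convexHull ℝ _ hwA) (subset_convexHull ℝ _ hwA')
      (a := X' / (X + X')) (b := X / (X + X')) (by positivity) (by positivity) (by field_simp; ring)
    have := (convex_convexHull ℝ _).smul_mem_of_zero_mem
      (zero_mem_convexHull hwA (hsymm _ hwA)) hc (t := 1 / h)
      ⟨by positivity, (div_le_one (by linarith)).2 h1⟩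
    convert this using 1
    refine plane_ext ?_ ?_
    · simp; field_simp; simp
    · simp; field_simp; ring
  exact ⟨hsymm, hwA, hwA', hX, hX', h1, hle',
    fun q hq => hS.innerSide hv (by norm_num) hX hX' h1 (by simpa using hw) (by simpa using hw')
      hq.1 (hle' q hq),
    fun q hq => hS.innerSide hv (by norm_num) hX' hX h1 (by simpa using hw') (by simpa using hw)
      hq.1 (hle' q hq)⟩

/-! ### The square as final case and the induction for polygons. -/

theorem zero_mem_interior_of_symm {K : Set (EuclideanSpace ℝ (Fin 2))} (hK : Convex ℝ K)
    (hsymm : ∀ x ∈ K, -x ∈ K) (hint : (interior K).Nonempty) :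
    (0 : EuclideanSpace ℝ (Fin 2)) ∈ interior K := by
  obtain ⟨x, hx⟩ := hint
  have hx' : -x ∈ interior K := by
    refine mem_interior.2 ⟨-interior K, fun y hy => ?_, isOpen_interior.neg, by simpa using hx⟩
    simpa using hsymm _ (interior_subset (Set.mem_neg.1 hy))
  have := hK.interior hx hx' (a := 1 / 2) (b := 1 / 2) (by norm_num) (by norm_num) (by norm_num)
  simpa using this

theorem interior_nonempty_of_volume_ne_zero {K : Set (EuclideanSpace ℝ (Fin 2))} (hK : Convex ℝ K)
    (hvol : volume K ≠ 0) : (interior K).Nonempty := by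
  by_contra hcon
  rw [not_nonempty_iff_eq_empty] at hcon
  apply hvol
  refine measure_mono_null ?_ (hK.addHaar_frontier volume)
  rw [frontier, hcon, sdiff_empty]
  exact subset_closure

theorem isCompact_cube (n : ℕ) : IsCompact (cube n) := by
  have : cube n = (EuclideanSpace.equiv (Fin n) ℝ).toHomeomorph ⁻¹'
      (Set.pi univ fun _ => Icc (-1 : ℝ) 1) := by
    ext x
    simp only [cube, mem_ofPred_eq, mem_preimage, Set.mem_pi, mem_univ, true_implies]
    rfl
  rw [this, Homeomorph.isCompact_preimage]
  exact isCompact_univ_pi fun _ => isCompact_Icc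

/-- A cube is the hull of its vertices, in the form needed for linear images of it. -/
theorem image_cube_eq {X : ℝ} (hX : 0 < X) {S : Set (EuclideanSpace ℝ (Fin 2))}
    (hS : ∀ x ∈ S, -x ∈ S) (hv : !₂[0, 1] ∈ S) (hw : !₂[X, 0] ∈ S)
    (hle : ∀ q ∈ S, q ≠ !₂[0, 1] → q ≠ -!₂[0, 1] → q 1 = 0 ∧ |q 0| ≤ X) :
    planeMap (X / 2) (-(X / 2)) (1 / 2) (1 / 2) '' cube 2 = convexHull ℝ S := by
  -- The map sends the vertices `(1, 1)` and `(1, -1)` of the square to `(0, 1)` and `(X, 0)`. For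
  -- the first inclusion, the image point is interpolated along two opposite edges and then between
  -- them.
  apply Subset.antisymm
  · rintro _ ⟨x, hx, rfl⟩
    obtain ⟨h0, h0'⟩ := hx 0
    obtain ⟨h1, h1'⟩ := hx 1
    have hc := convex_convexHull ℝ S
    have hv₁ := subset_convexHull ℝ S hv
    have hv₂ := subset_convexHull ℝ S (hS _ hv)
    have hw₁ := subset_convexHull ℝ S hw
    have hw₂ := subset_convexHull ℝ S (hS _ hw)
    have k1 := hc hv₁ hw₁ (a := (1 + x 1) / 2) (b := (1 - x 1) / 2) (by linarith) (by linarith)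
      (by ring)
    have k2 := hc hw₂ hv₂ (a := (1 + x 1) / 2) (b := (1 - x 1) / 2) (by linarith) (by linarith)
      (by ring)
    have := hc k1 k2 (a := (1 + x 0) / 2) (b := (1 - x 0) / 2) (by linarith) (by linarith) (by ring)
    convert this using 1
    rw [planeMap_apply]
    refine plane_ext ?_ ?_
    · simp; ring
    · simp; ring
  · have hcube : Convex ℝ (cube 2) := by
      intro x hx y hy a b ha hb hab i
      exact convex_Icc (-1 : ℝ) 1 (hx i) (hy i) ha hb hab
    refine convexHull_min (fun q hq => ?_) (hcube.linear_image _)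
    by_cases h1 : q = !₂[0, 1]
    · refine ⟨!₂[1, 1], fun i => by fin_cases i <;> norm_num, ?_⟩
      rw [h1, planeMap_apply]
      exact plane_ext (by simp) (by norm_num)
    by_cases h2 : q = -!₂[0, 1]
    · refine ⟨!₂[-1, -1], fun i => by fin_cases i <;> norm_num, ?_⟩
      rw [h2, planeMap_apply]
      exact plane_ext (by simp) (by norm_num)
    obtain ⟨hq1, hq0⟩ := hle q hq h1 h2
    obtain ⟨ha, hb⟩ := abs_le.1 hq0
    have ha' : -1 ≤ q 0 / X := by rw [le_div_iff₀ hX]; linarith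
    have hb' : q 0 / X ≤ 1 := by rw [div_le_iff₀ hX]; linarith
    refine ⟨!₂[q 0 / X, -(q 0 / X)], fun i => ?_, ?_⟩
    · fin_cases i
      · exact ⟨ha', hb'⟩
      · exact ⟨neg_le_neg hb', by simpa using neg_le_neg ha'⟩
    · rw [planeMap_apply]
      refine plane_ext ?_ ?_
      · simp; field_simp; ring
      · simp [hq1]

/-- The inequality for symmetric polygons. -/
theorem lpMahler_cube_le_of_finite {p : ℝ} (hp : 0 < p) (n : ℕ) :
    ∀ S : Set (EuclideanSpace ℝ (Fin 2)), S.ncard = n → S.Finite → (∀ x ∈ S, -x ∈ S) →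
      volume (convexHull ℝ S) ≠ 0 → lpMahler p (cube 2) ≤ lpMahler p (convexHull ℝ S) := by
  induction n using Nat.strong_induction_on with
  | _ n ih =>
  intro S hn hf hsymm hvol
  by_cases hmin : ∀ w ∈ S, w ∉ convexHull ℝ (S \ {w, -w})
  swap
  · push Not at hmin
    obtain ⟨w, hw, hmem⟩ := hmin
    have he := convexHull_diff_pair hsymm hmem
    rw [← he]
    refine ih _ ?_ _ rfl (hf.subset sdiff_subset) (neg_mem_diff_pair hsymm) (by rwa [he])
    rw [← hn]
    exact ncard_lt_ncard ⟨sdiff_subset, fun h => (h hw).2 (by simp)⟩ hf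
  have hS : IsMinimalSymm S := ⟨hf, hsymm, hmin⟩
  obtain ⟨L, hL, X, X', h, hX, hX', hv, hw, hw', hle⟩ := hS.exists_normal_form hvol
  have hdet := det_ne_zero_of_injective hL
  have hSL := hS.image hL
  have hcard : (L '' S).ncard = n := by rw [ncard_image_of_injective _ hL, hn]
  have hinv : lpMahler p (convexHull ℝ (L '' S)) = lpMahler p (convexHull ℝ S) := by
    rw [← LinearMap.image_convexHull]
    exact lpMahler_image_linearMap (hf.isCompact_convexHull ℝ) hvol L hdet
  have hvolL : volume (convexHull ℝ (L '' S)) ≠ 0 := by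
    rw [← LinearMap.image_convexHull, Measure.addHaar_image_linearMap]
    exact mul_ne_zero (by simpa using hdet) hvol
  rw [← hinv]
  clear hinv hvol hmin hn hS hsymm hf
  generalize L '' S = T at *
  have H := hSL.capped hX hX' hv hw hw' hle
  have hTe : convexHull ℝ T = cappedHull (T \ {!₂[0, 1], -!₂[0, 1]}) 0 := by
    rw [cappedHull, sdiff_union_of_subset]
    rintro x (rfl | rfl)
    · exact hv
    · exact hSL.symm _ hv
  -- At shoulder level `0` all points but the apexes lie on the horizontal axis, so the hull is a
  -- parallelogram. At positive level a pair of vertices can be moved.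
  rcases H.level_nonneg.eq_or_lt with h0 | h0
  · subst h0
    have hzero : ∀ q ∈ T \ {!₂[0, 1], -!₂[0, 1]}, q 1 = 0 := fun q hq =>
      le_antisymm (H.le_level q hq) (by simpa using H.le_level _ (H.symm q hq))
    have hright : ∀ q ∈ T \ {!₂[0, 1], -!₂[0, 1]}, q 0 ≤ X := by
      intro q hq
      have := H.right_side q hq
      simpa [InnerSide, hzero q hq] using this
    have he := image_cube_eq hX hSL.symm hv hw fun q hq h1 h2 => by
      have hq' : q ∈ T \ {!₂[0, 1], -!₂[0, 1]} := ⟨hq, by simp [h1, h2]⟩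
      refine ⟨hzero q hq', abs_le.2 ⟨?_, hright q hq'⟩⟩
      have := hright _ (H.symm q hq')
      simp at this
      linarith
    have hinj : Function.Injective (planeMap (X / 2) (-(X / 2)) (1 / 2) (1 / 2)) :=
      injective_planeMap (by ring_nf; simpa using hX.ne')
    have hcv : volume (cube 2) ≠ 0 := by
      intro hc
      rw [← he, Measure.addHaar_image_linearMap, hc, mul_zero] at hvolL
      exact hvolL rfl
    rw [← he, lpMahler_image_linearMap (isCompact_cube 2) hcv _ (det_ne_zero_of_injective hinj)]
  · have hint := zero_mem_interior_of_symm (convex_convexHull ℝ T) (neg_mem_convexHull hSL.symm)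
      (interior_nonempty_of_volume_ne_zero (convex_convexHull ℝ T) hvolL)
    rw [hTe] at hint ⊢
    obtain ⟨S₁, S₂, ⟨hf₁, hs₁, hc₁, hv₁⟩, ⟨hf₂, hs₂, hc₂, hv₂⟩, hle'⟩ :=
      H.exists_fewer_min_lpMahler_le hp (hSL.finite.subset sdiff_subset) h0 hint
    have hcT : (T \ {!₂[0, 1], -!₂[0, 1]}).ncard + 2 = n := by
      have hne : (!₂[0, 1] : EuclideanSpace ℝ (Fin 2)) ≠ -!₂[0, 1] := fun e => by
        have := congrArg (fun z => z 1) e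
        norm_num at this
      have hsub : {!₂[0, 1], -!₂[0, 1]} ⊆ T := by
        rintro x (rfl | rfl)
        · exact hv
        · exact hSL.symm _ hv
      have := ncard_sdiff_add_ncard_of_subset hsub hSL.finite
      rwa [ncard_pair hne, hcard] at this
    exact (le_min (ih _ (hcT ▸ hc₁) S₁ rfl hf₁ hs₁ hv₁)
      (ih _ (hcT ▸ hc₂) S₂ rfl hf₂ hs₂ hv₂)).trans hle'

/-! ### Approximation by polygons and conclusion. -/

/-- Approximation of a symmetric convex body from outside by symmetric polygons. -/
theorem exists_polygon_between {K : Set (EuclideanSpace ℝ (Fin 2))} (hcompact : IsCompact K)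
    (hconvex : Convex ℝ K) (hsymm : ∀ x ∈ K, -x ∈ K)
    (h0 : (0 : EuclideanSpace ℝ (Fin 2)) ∈ interior K) {c : ℝ} (hc : 1 < c) :
    ∃ S : Set (EuclideanSpace ℝ (Fin 2)), S.Finite ∧ (∀ x ∈ S, -x ∈ S) ∧
      K ⊆ convexHull ℝ S ∧ convexHull ℝ S ⊆ (c • LinearMap.id :
        EuclideanSpace ℝ (Fin 2) →ₗ[ℝ] EuclideanSpace ℝ (Fin 2)) '' K := by
  set D := (c • LinearMap.id :
        EuclideanSpace ℝ (Fin 2) →ₗ[ℝ] EuclideanSpace ℝ (Fin 2)) '' K with hD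
  have hDc : Convex ℝ D := hconvex.linear_image _
  have hDs : ∀ x ∈ D, -x ∈ D := by
    rintro _ ⟨x, hx, rfl⟩
    exact ⟨-x, hsymm x hx, map_neg _ x⟩
  -- Since `0` is interior, `K` lies in the interior of `c K`. Each point of `K` then has a simplex
  -- neighbourhood inside `c K`, and finitely many of these cover `K`.
  have hKD : ∀ x ∈ K, D ∈ 𝓝 x := by
    intro x hx
    have := hconvex.closure_subset_interior_image_homothety_of_one_lt h0 c hc (subset_closure hx)
    have he : AffineMap.homothety (0 : EuclideanSpace ℝ (Fin 2)) c '' K = D := by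
      rw [hD]
      refine image_congr fun y _ => ?_
      simp [AffineMap.homothety_apply]
    rw [he] at this
    exact mem_interior_iff_mem_nhds.1 this
  have hF : ∀ x : EuclideanSpace ℝ (Fin 2), ∃ F : Set (EuclideanSpace ℝ (Fin 2)), F.Finite ∧
      (x ∈ K → convexHull ℝ F ∈ 𝓝 x ∧ F ⊆ D) := by
    intro x
    by_cases hx : x ∈ K
    · obtain ⟨b, hb, hbD⟩ := exists_mem_interior_convexHull_affineBasis (hKD x hx)
      exact ⟨range b, finite_range b, fun _ =>
        ⟨mem_interior_iff_mem_nhds.1 hb, (subset_convexHull ℝ _).trans hbD⟩⟩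
    · exact ⟨∅, finite_empty, fun h => absurd h hx⟩
  choose F hFf hFK using hF
  obtain ⟨t, htK, hcov⟩ := hcompact.elim_nhds_subcover (fun x => convexHull ℝ (F x))
    fun x hx => (hFK x hx).1
  set U := ⋃ x ∈ t, F x with hU
  have hUf : U.Finite := t.finite_toSet.biUnion fun x _ => hFf x
  have hUD : U ⊆ D := iUnion₂_subset fun x hx => (hFK x (htK x hx)).2
  refine ⟨U ∪ -U, hUf.union hUf.neg, ?_, ?_, ?_⟩
  · rintro x (hx | hx)
    · exact Or.inr (by simpa using hx)
    · exact Or.inl hx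
  · refine hcov.trans (iUnion₂_subset fun x hx => convexHull_mono ?_)
    exact (subset_biUnion_of_mem (u := F) hx).trans subset_union_left
  · refine convexHull_min ?_ hDc
    rintro x (hx | hx)
    · exact hUD hx
    · simpa using hDs _ (hUD hx)

theorem mainTheorem2 (p : ℝ) (hp : 0 < p)
    (K : Set (EuclideanSpace ℝ (Fin 2))) (hcompact : IsCompact K) (hconvex : Convex ℝ K)
    (hinterior : (interior K).Nonempty) (hsymm : ∀ x ∈ K, -x ∈ K) :
    lpMahler p (cube 2) ≤ lpMahler p K := by
  have h0 := zero_mem_interior_of_symm hconvex hsymm hinterior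
  have hvol : volume K ≠ 0 := fun h =>
    (isOpen_interior.measure_pos volume hinterior).ne' (measure_mono_null interior_subset h)
  have hV := volume_real_pos hcompact hvol
  have hq : 0 < 1 + 1 / p := by positivity
  -- The polygon lies in `c K`, so its area is at most `c²` times that of `K`. The loss disappears
  -- as `c → 1`.
  have key : ∀ c : ℝ, 1 < c →
      lpMahler p (cube 2) * ENNReal.ofReal ((1 / c ^ 2) ^ (1 + 1 / p)) ≤ lpMahler p K := by
    intro c hc
    obtain ⟨S, hf, hs, hKS, hSc⟩ := exists_polygon_between hcompact hconvex hsymm h0 hc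
    have hSv : volume (convexHull ℝ S) ≠ 0 := fun h => hvol (measure_mono_null hKS h)
    have hScomp : IsCompact (convexHull ℝ S) := hf.isCompact_convexHull ℝ
    have hSV := volume_real_pos hScomp hSv
    have hle : volume.real (convexHull ℝ S) ≤ c ^ 2 * volume.real K := by
      have h1 : volume (convexHull ℝ S) ≤ ENNReal.ofReal (c ^ 2) * volume K := by
        refine (measure_mono hSc).trans_eq ?_
        rw [Measure.addHaar_image_linearMap]
        simp
      rw [Measure.real, Measure.real, ← ENNReal.toReal_ofReal (sq_nonneg c), ← ENNReal.toReal_mul]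
      exact ENNReal.toReal_mono (ENNReal.mul_ne_top ENNReal.ofReal_ne_top
        hcompact.measure_lt_top.ne) h1
    refine le_trans ?_ (lpMahler_mul_le_of_subset hp hcompact hScomp hvol hKS)
    refine mul_le_mul' (lpMahler_cube_le_of_finite hp _ S rfl hf hs hSv)
      (ENNReal.ofReal_le_ofReal (Real.rpow_le_rpow (by positivity) ?_ hq.le))
    rw [div_le_div_iff₀ (by positivity) hSV, one_mul, mul_comm]
    exact hle
  have hcont : ContinuousAt (fun c : ℝ => (1 / c ^ 2) ^ (1 + 1 / p)) 1 := by
    refine ContinuousAt.rpow_const ?_ (Or.inl (by norm_num))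
    exact ContinuousAt.div continuousAt_const (by fun_prop) (by norm_num)
  have hlim : Tendsto (fun c : ℝ => ENNReal.ofReal ((1 / c ^ 2) ^ (1 + 1 / p))) (𝓝[>] 1) (𝓝 1) := by
    have := (ENNReal.continuous_ofReal.tendsto _).comp (hcont.tendsto.mono_left
      (nhdsWithin_le_nhds (s := Ioi 1)))
    simpa [Function.comp_def] using this
  have hlim' := ENNReal.Tendsto.const_mul hlim (a := lpMahler p (cube 2)) (Or.inl one_ne_zero)
  rw [mul_one] at hlim'
  refine le_of_tendsto hlim' ?_
  filter_upwards [self_mem_nhdsWithin] with c hc using key c hc
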